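/- Let $K$ be an algebraically closed field, let $\Lambda=K\Gamma/I$ and $\Lambda'=K\Gamma'/I'$ be finite dimensional algebras presented by finite quivers and admissible ideals, and identify vertices of the quivers with the corresponding primitive idempotents. Let $J$ be the Jacobson radical of $\Lambda$, and let $\mathbb S=(S(0),\dots,S(l))$ be a sequence of simple left $\Lambda$-modules $S(i)=\Lambda e(i)/Je(i)$, where the $e(i)$ are vertices of $\Gamma$; put $e=e(0)$. A path through $\mathbb S$ is a path $p\in K\Gamma\setminus I$ of length $l$ passing through the vertices $e(0),\dots,e(l)$ in this order; its right subpath of length $i$ is denoted $p_i$. A detour on $p$ is a pair $(\alpha,p_m)$ with an arrow $\alpha$ such that $\alpha p_m$ is a path, $\alpha p_m\notin I$, $\alpha p_m\neq p_{m+1}$, and the set $I(\alpha,p_m)$ of all $s>m$ such that $p_s$ ends in the same vertex as $\alpha$ is nonempty. The affine variety $V_p$ consists of all families of scalars $k=(k_i(\alpha,p_m))$, indexed by the detours $(\alpha,p_m)$ on $p$ and $i\in I(\alpha,p_m)$, for which there are a uniserial left $\Lambda$-module $U$ with sequence of consecutive composition factors (from the top down) $\mathbb S$ and with $pU\neq0$,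 and an element $x=ex$ with $U=\Lambda x$, such that $\alpha p_mx=\sum_{i\in I(\alpha,p_m)}k_i(\alpha,p_m)\,p_ix$ for all detours. Let $m=\dim_K\Lambda e-(l+1)$. Inside the Grassmannian of $m$-dimensional subspaces of $\Lambda e$, let $\mathcal G\text{-}\mathrm{Uni}(p)$ be the set of those $\Lambda$-submodules of $\Lambda e$ which complement $A_p=\sum_{i=0}^lKp_i$, and let $\mathcal G\text{-}\mathrm{Uni}(\mathbb S)=\bigcup_p\mathcal G\text{-}\mathrm{Uni}(p)$, where $p$ traces the paths through $\mathbb S$, with the structure of a variety induced from the Grassmannian. Let $\psi_p:V_p\to\mathcal G\text{-}\mathrm{Uni}(p)$ send $k$ to the submodule of $\Lambda e$ generated by the elements $\alpha p_m-\sum_{i\in I(\alpha,p_m)}k_i(\alpha,p_m)p_i$, for the detours $(\alpha,p_m)$ on $p$, and by all paths $q$ starting in $e$ whose sequence of vertices is not a subsequence of $(e(0),\dots,e(l))$. Now let $f:\Lambda\to\Lambda'$ be an isomorphism of $K$-algebras, and let $\mathbb S'=(S'(0),\dots,S'(l))$, $S'(i)=\Lambda'e'(i)/J'e'(i)$ with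 vertices $e'(i)$ of $\Gamma'$, be the sequence of simple left $\Lambda'$-modules corresponding to $\mathbb S$ under $f$, that is, for each $i$ there is an additive bijection $g:S(i)\to S'(i)$ with $g(\lambda x)=f(\lambda)g(x)$. Then: (1) There is an isomorphism of varieties $\varphi:\mathcal G\text{-}\mathrm{Uni}(\mathbb S)\to\mathcal G\text{-}\mathrm{Uni}(\mathbb S')$. It can be chosen to be induced by $f$: there is an additive bijection $T:\Lambda e(0)\to\Lambda'e'(0)$ with $T(\lambda x)=f(\lambda)T(x)$ for $\lambda\in\Lambda$ and $x\in\Lambda e(0)$, such that $\varphi(C)=T(C)$ for all $C$. (2) Regard the irreducible components of the varieties $V_p$, where $p$ traces the paths through $\mathbb S$, as patches of $\mathcal G\text{-}\mathrm{Uni}(\mathbb S)$: components $D$ of $V_p$ and $E$ of $V_q$ are identified if $\psi_p(D)$ and $\psi_q(E)$ have the same closure in $\mathcal G\text{-}\mathrm{Uni}(\mathbb S)$; proceed likewise for the varieties $V_{p'}$, where $p'$ traces the paths in $\Gamma'$ through $\mathbb S'$. Distinct components of one and the same $V_p$ (or of one and the same $V_{p'}$) are never identified. With these identifications, $\varphi$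 induces a one-to-one correspondence between the collection of all irreducible components of the $V_p$ and the collection of all irreducible components of the $V_{p'}$: the component represented by $D\subseteq V_p$ corresponds to the one represented by $D'\subseteq V_{p'}$ if and only if $\varphi\big(\overline{\psi_p(D)}\big)=\overline{\psi_{p'}(D')}$. Whenever $D$ and $D'$ represent partners under this correspondence, they are birationally equivalent. -/

import Mathlib

/-! ## The path algebra of a finite quiver -/

section PathAlgebra

universe u v w

/-- A path of arbitrary source and target in a quiver. -/
abbrev AnyPath (V : Type v) [Quiver.{w} V] : Type (max v w) :=
  Σ a : V, Σ b : V, Quiver.Path a b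

/-- The path `p : a → b`, forgetting its endpoints. -/
abbrev Quiver.Path.toAny {V : Type v} [Quiver.{w} V] {a b : V} (p : Quiver.Path a b) :
    AnyPath V := ⟨a, b, p⟩

/-- The path algebra `KΓ`: the vector space with basis the paths of the quiver. -/
def PathAlgebra (K : Type u) [Field K] (V : Type v) [Quiver.{w} V] : Type (max u v w) :=
  AnyPath V →₀ K

namespace PathAlgebra

variable (K : Type u) [Field K] {V : Type v} [Quiver.{w} V]

noncomputable instance : AddCommGroup (PathAlgebra K V) :=
  inferInstanceAs (AddCommGroup (AnyPath V →₀ K))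

noncomputable instance : Module K (PathAlgebra K V) :=
  inferInstanceAs (Module K (AnyPath V →₀ K))

/-- The coefficients of an element of `KΓ` with respect to the basis of paths. -/
noncomputable def coeff : PathAlgebra K V ≃ₗ[K] (AnyPath V →₀ K) :=
  LinearEquiv.refl K (AnyPath V →₀ K)

/-- The basis element of `KΓ` given by a path. -/
noncomputable def of {a b : V} (p : Quiver.Path a b) : PathAlgebra K V :=
  (coeff K).symm (Finsupp.single p.toAny 1)

/-- The linear map on `KΓ` with prescribed values on the paths. -/
noncomputable def lift {M : Type*} [AddCommGroup M] [Module K M] (g : AnyPath V → M) :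
    PathAlgebra K V →ₗ[K] M :=
  Finsupp.linearCombination K g ∘ₗ (coeff K).toLinearMap

theorem lift_of {M : Type*} [AddCommGroup M] [Module K M] (g : AnyPath V → M) {a b : V}
    (p : Quiver.Path a b) : lift K g (of K p) = g p.toAny := by
  simp [lift, of]

open Classical in
/-- The product `q p` ("`q` after `p`") of two basis paths: it is the composite path if `p` ends
where `q` starts, and `0` otherwise. -/
noncomputable def pathMul (q p : AnyPath V) : PathAlgebra K V :=
  if h : p.2.1 = q.1 then of K ((p.2.2.cast rfl h).comp q.2.2) else 0

/-- The multiplication of `KΓ`, the bilinear extension of the product of paths. -/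
noncomputable def mulHom : PathAlgebra K V →ₗ[K] PathAlgebra K V →ₗ[K] PathAlgebra K V :=
  lift K fun q => lift K fun p => pathMul K q p

noncomputable instance : Mul (PathAlgebra K V) := ⟨fun x y => mulHom K x y⟩

noncomputable instance [Fintype V] : One (PathAlgebra K V) :=
  ⟨∑ a : V, of K (Quiver.Path.nil : Quiver.Path a a)⟩

theorem mul_def (x y : PathAlgebra K V) : x * y = mulHom K x y := rfl

theorem one_def [Fintype V] :
    (1 : PathAlgebra K V) = ∑ a : V, of K (Quiver.Path.nil : Quiver.Path a a) := rfl

theorem of_mul_of_any (q p : AnyPath V) : of K q.2.2 * of K p.2.2 = pathMul K q p := by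
  rw [mul_def, mulHom, lift_of, lift_of]

theorem of_mul_of {a b c : V} (q : Quiver.Path b c) (p : Quiver.Path a b) :
    of K q * of K p = of K (p.comp q) := by
  have := of_mul_of_any K q.toAny p.toAny
  simpa [pathMul] using this

theorem of_mul_of_ne {a b b' c : V} (q : Quiver.Path b' c) (p : Quiver.Path a b) (h : b ≠ b') :
    of K q * of K p = 0 := by
  have := of_mul_of_any K q.toAny p.toAny
  simpa [pathMul, h] using this

variable {K} in
@[elab_as_elim]
theorem induction_on {P : PathAlgebra K V → Prop} (x : PathAlgebra K V) (h0 : P 0)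
    (hadd : ∀ x y, P x → P y → P (x + y))
    (hof : ∀ (c : K) {a b : V} (p : Quiver.Path a b), P (c • of K p)) : P x := by
  have key : ∀ f : AnyPath V →₀ K, P ((coeff K).symm f) := by
    intro f
    induction f using Finsupp.induction_linear with
    | zero => simpa using h0
    | add f g hf hg => simpa using hadd _ _ hf hg
    | single p c =>
      have h := hof c p.2.2
      rwa [of, ← map_smul, Finsupp.smul_single, smul_eq_mul, mul_one] at h
  simpa using key (coeff K x)

theorem smul_mul' (c : K) (x y : PathAlgebra K V) : (c • x) * y = c • (x * y) := by
  simp [mul_def]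

theorem mul_smul' (c : K) (x y : PathAlgebra K V) : x * (c • y) = c • (x * y) := by
  simp [mul_def]

noncomputable instance : NonUnitalNonAssocRing (PathAlgebra K V) where
  left_distrib x y z := by simp [mul_def]
  right_distrib x y z := by simp [mul_def]
  zero_mul x := by simp [mul_def]
  mul_zero x := by simp [mul_def]

theorem mul_assoc' (x y z : PathAlgebra K V) : x * y * z = x * (y * z) := by
  induction x using induction_on with
  | h0 => simp
  | hadd x x' h h' => simp only [add_mul, h, h']
  | hof c r =>
  induction y using induction_on with
  | h0 => simp
  | hadd y y' h h' => simp only [add_mul, mul_add, h, h']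
  | hof d q =>
  induction z using induction_on with
  | h0 => simp
  | hadd y y' h h' => simp only [mul_add, h, h']
  | @hof e a b p =>
  rename_i a₁ b₁ a₂ b₂
  simp only [smul_mul', mul_smul']
  congr 3
  by_cases h1 : b₂ = a₁
  · subst h1
    rw [of_mul_of]
    by_cases h2 : b = a₂
    · subst h2
      rw [of_mul_of, of_mul_of, of_mul_of, Quiver.Path.comp_assoc]
    · rw [of_mul_of_ne _ _ _ h2, of_mul_of_ne _ _ _ h2, mul_zero]
  · rw [of_mul_of_ne _ _ _ h1, zero_mul]
    by_cases h2 : b = a₂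
    · subst h2
      rw [of_mul_of, of_mul_of_ne _ _ _ h1]
    · rw [of_mul_of_ne _ _ _ h2, mul_zero]

theorem one_mul' [Fintype V] (x : PathAlgebra K V) : 1 * x = x := by
  induction x using induction_on with
  | h0 => simp
  | hadd x y h h' => simp only [mul_add, h, h']
  | @hof c a b p =>
  rw [mul_smul', one_def, Finset.sum_mul, Finset.sum_eq_single b]
  · rw [of_mul_of, Quiver.Path.comp_nil]
  · intro d _ hd
    exact of_mul_of_ne _ _ _ hd.symm
  · simp

theorem mul_one' [Fintype V] (x : PathAlgebra K V) : x * 1 = x := by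
  induction x using induction_on with
  | h0 => simp
  | hadd x y h h' => simp only [add_mul, h, h']
  | @hof c a b p =>
  rw [smul_mul', one_def, Finset.mul_sum, Finset.sum_eq_single a]
  · rw [of_mul_of, Quiver.Path.nil_comp]
  · intro d _ hd
    exact of_mul_of_ne _ _ _ hd
  · simp

noncomputable instance [Fintype V] : Ring (PathAlgebra K V) where
  __ := (inferInstance : NonUnitalNonAssocRing (PathAlgebra K V))
  mul_assoc := mul_assoc' K
  one_mul := one_mul' K
  mul_one := mul_one' K

noncomputable instance [Fintype V] : Algebra K (PathAlgebra K V) :=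
  Algebra.ofModule (smul_mul' K) (fun c x y => mul_smul' K c x y)

variable {K} in
/-- An ideal `I` of `KΓ` is admissible if `R ^ N ⊆ I ⊆ R ^ 2` for some `N`, where `R` is the ideal
generated by the arrows (so that `R ^ n` is spanned by the paths of length at least `n`). -/
def IsAdmissible [Fintype V] (I : Ideal (PathAlgebra K V)) : Prop :=
  (∀ x ∈ I, ∀ p ∈ (coeff K x).support, 2 ≤ p.2.2.length) ∧
    ∃ N : ℕ, ∀ (a b : V) (p : Quiver.Path a b), N ≤ p.length → of K p ∈ I

end PathAlgebra

end PathAlgebra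

/-! ## Spaces with functions: classical varieties over an algebraically closed field -/

section SpaceWithFunctions

universe u

/-- A topology on `X` together with a notion of regular function on each open set. Only the values
of `f` on `U` matter in `IsRegular U f`. -/
structure SpaceWithFunctions (K : Type*) (X : Type*) where
  /-- the (Zariski) topology -/
  top : TopologicalSpace X
  /-- `f` is regular on the open set `U` -/
  IsRegular : Set X → (X → K) → Prop

namespace SpaceWithFunctions

variable {K X Y : Type*}

/-- The structure induced on a subset: the subspace topology, and the functions which locally
extend to regular functions of the ambient space. On locally closed subsets of a variety this
is the structure of a (reduced) subvariety. -/
def induce (A : SpaceWithFunctions K X) (T : Set X) : SpaceWithFunctions K T where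
  top := A.top.induced Subtype.val
  IsRegular U f := ∀ x ∈ U, ∃ N : Set X, A.top.IsOpen N ∧ (x : X) ∈ N ∧
    ∃ g : X → K, A.IsRegular N g ∧ ∀ y : T, (y : X) ∈ N → y ∈ U → f y = g y

/-- Isomorphisms: homeomorphisms which identify the regular functions on open sets. -/
structure Iso (A : SpaceWithFunctions K X) (B : SpaceWithFunctions K Y) extends X ≃ Y where
  isOpen_iff : ∀ U : Set Y, B.top.IsOpen U ↔ A.top.IsOpen (toFun ⁻¹' U)
  isRegular_iff : ∀ U : Set Y, B.top.IsOpen U → ∀ f : Y → K,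
    B.IsRegular U f ↔ A.IsRegular (toFun ⁻¹' U) (f ∘ toFun)

/-- The irreducible components, as subsets. -/
def components (A : SpaceWithFunctions K X) : Set (Set X) :=
  @irreducibleComponents X A.top

/-- The closure of a subset. -/
def cl (A : SpaceWithFunctions K X) (T : Set X) : Set X :=
  @closure X A.top T

/-- Birational equivalence (of irreducible varieties): there are isomorphic nonempty open
subvarieties. -/
def Birational (A : SpaceWithFunctions K X) (B : SpaceWithFunctions K Y) : Prop :=
  ∃ (U : Set X) (W : Set Y), A.top.IsOpen U ∧ U.Nonempty ∧ B.top.IsOpen W ∧ W.Nonempty ∧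
    Nonempty ((A.induce U).Iso (B.induce W))

end SpaceWithFunctions

/-- Affine space with coordinates indexed by `ι`: the Zariski topology, and the functions that are
locally quotients of polynomials. -/
def affineSpace (K : Type*) [Field K] (ι : Type*) : SpaceWithFunctions K (ι → K) where
  top := TopologicalSpace.generateFrom
    {U | ∃ F : MvPolynomial ι K, U = {x | MvPolynomial.eval x F ≠ 0}}
  IsRegular U f := ∀ x ∈ U, ∃ F G : MvPolynomial ι K, MvPolynomial.eval x G ≠ 0 ∧
    ∀ y ∈ U, MvPolynomial.eval y G ≠ 0 → f y = MvPolynomial.eval y F / MvPolynomial.eval y G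

/-- The `m`-dimensional subspaces of a vector space. -/
def Gr (K : Type*) [Field K] (W : Type*) [AddCommGroup W] [Module K W] (m : ℕ) : Type _ :=
  {D : Submodule K W // Module.finrank K D = m}

namespace Gr

variable {K : Type*} [Field K] {W : Type*} [AddCommGroup W] [Module K W] {m : ℕ}

/-- `v` is a basis of the subspace `D`. -/
def IsFrame (D : Gr K W m) (v : Fin m → W) : Prop :=
  LinearIndependent K v ∧ Submodule.span K (Set.range v) = D.1

/-- Evaluation of a polynomial in the Plücker coordinates at the Plücker vector
`v 0 ∧ ⋯ ∧ v (m - 1)`; linear forms on the exterior power are alternating forms on `W`. -/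
noncomputable def pluckerEval (v : Fin m → W) (F : MvPolynomial (W [⋀^Fin m]→ₗ[K] K) K) : K :=
  MvPolynomial.eval (fun ω => ω v) F

variable (K W m) in
/-- The Grassmannian of `m`-dimensional subspaces of a finite dimensional vector space `W`, with the
structure of a projective variety given by the Plücker embedding: the open sets are generated by
the sets on which a homogeneous polynomial in the Plücker coordinates does not vanish, and the
regular functions are locally quotients of homogeneous polynomials of the same degree. -/
def grassmannian : SpaceWithFunctions K (Gr K W m) where
  top := TopologicalSpace.generateFrom
    {U | ∃ (d : ℕ) (F : MvPolynomial (W [⋀^Fin m]→ₗ[K] K) K), F.IsHomogeneous d ∧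
      U = {D | ∃ v, IsFrame D v ∧ pluckerEval v F ≠ 0}}
  IsRegular U f := ∀ D ∈ U, ∃ (d : ℕ) (F G : MvPolynomial (W [⋀^Fin m]→ₗ[K] K) K),
    F.IsHomogeneous d ∧ G.IsHomogeneous d ∧ (∃ v, IsFrame D v ∧ pluckerEval v G ≠ 0) ∧
    ∀ E ∈ U, ∀ v, IsFrame E v → pluckerEval v G ≠ 0 → f E = pluckerEval v F / pluckerEval v G

end Gr

end SpaceWithFunctions

/-! ## Uniserial modules and their varieties -/

section Uniserial

universe u v w

variable {K : Type u} [Field K] {V : Type v} [Fintype V] [Quiver.{w} V]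
variable (I : Ideal (PathAlgebra K V)) [I.IsTwoSided]

/-- The algebra `Λ = KΓ / I`. -/
abbrev QuiverAlgebra : Type (max u v w) := PathAlgebra K V ⧸ I

namespace QuiverAlgebra

/-- The residue class in `Λ` of a path. -/
noncomputable def path {a b : V} (q : Quiver.Path a b) : QuiverAlgebra I :=
  Ideal.Quotient.mk I (PathAlgebra.of K q)

/-- The primitive idempotent of `Λ` given by a vertex. -/
noncomputable def idem (a : V) : QuiverAlgebra I := path I (Quiver.Path.nil : Quiver.Path a a)

theorem path_mul_idem {a b : V} (q : Quiver.Path a b) : path I q * idem I a = path I q := by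
  rw [idem, path, path, ← map_mul, PathAlgebra.of_mul_of, Quiver.Path.nil_comp]

/-- The left `Λ`-module `Λe`, for the vertex `e = a`. -/
noncomputable def proj (a : V) : Submodule (QuiverAlgebra I) (QuiverAlgebra I) :=
  Submodule.span (QuiverAlgebra I) {idem I a}

/-- The submodule `Je` of `Λe`, where `J` is the Jacobson radical. -/
noncomputable def radProj (a : V) : Submodule (QuiverAlgebra I) (proj I a) :=
  Submodule.comap (proj I a).subtype
    (Submodule.map (LinearMap.toSpanSingleton (QuiverAlgebra I) (QuiverAlgebra I) (idem I a))
      (Ring.jacobson (QuiverAlgebra I)))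

/-- The simple left `Λ`-module `Λe / Je`. -/
abbrev Simple (a : V) : Type (max u v w) := proj I a ⧸ radProj I a

/-- A path starting at the vertex `a`, as an element of `Λe`. -/
noncomputable def projPath {a b : V} (q : Quiver.Path a b) : proj I a :=
  ⟨path I q, Submodule.mem_span_singleton.2 ⟨path I q, path_mul_idem I q⟩⟩

variable {l : ℕ} (S : Fin (l + 1) → V)

/-- The right subpaths `p₀, …, p_l` of the path of length `l` with the given arrows
`S i → S (i + 1)`; thus `p_i` has length `i`. -/
def subpath {V : Type v} [Quiver.{w} V] {l : ℕ} {S : Fin (l + 1) → V}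
    (γ : ∀ i : Fin l, S i.castSucc ⟶ S i.succ) : ∀ i : Fin (l + 1), Quiver.Path (S 0) (S i) :=
  Fin.induction Quiver.Path.nil (fun i q => q.cons (γ i))

/-- The paths in `KΓ ∖ I` of length `l` through the sequence `S` of vertices. -/
def PathThrough : Type w :=
  {γ : ∀ i : Fin l, S i.castSucc ⟶ S i.succ // PathAlgebra.of K (subpath γ (Fin.last l)) ∉ I}

/-- The left `Λ`-module `U` is uniserial, and its sequence of consecutive composition factors,
from the top down, is `(S(0), …, S(l))`. -/
def IsUniserial (U : Type*) [AddCommGroup U] [Module (QuiverAlgebra I) U] : Prop :=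
  (∀ A B : Submodule (QuiverAlgebra I) U, A ≤ B ∨ B ≤ A) ∧
    ∃ F : Fin (l + 2) → Submodule (QuiverAlgebra I) U, F 0 = ⊤ ∧ F (Fin.last (l + 1)) = ⊥ ∧
      ∀ i : Fin (l + 1), F i.succ ≤ F i.castSucc ∧
        Nonempty ((F i.castSucc ⧸ (F i.succ).submoduleOf (F i.castSucc))
          ≃ₗ[QuiverAlgebra I] Simple I (S i))

variable {I S}

/-- The right subpath `p_i` of `p`. -/
def PathThrough.sub (p : PathThrough I S) (i : Fin (l + 1)) : Quiver.Path (S 0) (S i) :=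
  subpath p.1 i

/-- The detours `(α, p_m)` on `p`: here `α` is an arrow `S m → tgt` such that the path `α p_m` does
not belong to `I` and is different from `p_{m+1}`, and some `p_s` with `s > m` ends in the same
vertex as `α`. -/
structure Detour (p : PathThrough I S) where
  m : Fin (l + 1)
  tgt : V
  α : S m ⟶ tgt
  not_mem : PathAlgebra.of K ((p.sub m).cons α) ∉ I
  ne : ∀ i : Fin l, i.castSucc = m → ((p.sub m).cons α).toAny ≠ (p.sub i.succ).toAny
  exists_index : ∃ s : Fin (l + 1), m < s ∧ S s = tgt

/-- The path `α p_m`, for a detour `(α, p_m)`. -/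
def Detour.path {p : PathThrough I S} (d : Detour p) : Quiver.Path (S 0) d.tgt :=
  (p.sub d.m).cons d.α

/-- The index set `I(α, p_m)` of a detour. -/
abbrev Detour.Index {p : PathThrough I S} (d : Detour p) : Type :=
  {s : Fin (l + 1) // d.m < s ∧ S s = d.tgt}

/-- The set of coordinates of `V_p`. -/
abbrev PathThrough.Coord (p : PathThrough I S) : Type (max v w) := Σ d : Detour p, d.Index

open Classical in
/-- The element `∑ k_i(α, p_m) p_i` of `Λe`, the sum over the indices `i` in `I(α, p_m)`. -/
noncomputable def Detour.combination {p : PathThrough I S} (k : p.Coord → K) (d : Detour p) :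
    proj I (S 0) :=
  ∑ i : d.Index, k ⟨d, i⟩ • projPath I (p.sub i.1)

/-- The points of `V_p`: the families of scalars such that, for some uniserial module `U` with
composition series `S` and mast `p`, and some top element `x = e x` of `U`, we have
`α p_m x = ∑ k_i(α, p_m) p_i x` for all detours. -/
def uniserialSet (p : PathThrough I S) : Set (p.Coord → K) :=
  {k | ∃ (U : Type (max u v w)) (_ : AddCommGroup U) (_ : Module (QuiverAlgebra I) U) (x : U),
    IsUniserial I S U ∧ (∃ y : U, path I (p.sub (Fin.last l)) • y ≠ 0) ∧
    idem I (S 0) • x = x ∧ Submodule.span (QuiverAlgebra I) {x} = ⊤ ∧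
    ∀ d : Detour p, path I d.path • x = (d.combination k : QuiverAlgebra I) • x}

/-- The affine variety `V_p`. -/
def uniserialVariety (p : PathThrough I S) : SpaceWithFunctions K (uniserialSet p) :=
  (affineSpace K p.Coord).induce (uniserialSet p)

/-- A path `q` starting in `S 0` is a route on the paths through `S` if the sequence of vertices
through which it passes is a subsequence of `S`. -/
def IsRoute (S : Fin (l + 1) → V) {b : V} (q : Quiver.Path (S 0) b) : Prop :=
  q.vertices.Sublist (List.ofFn S)

/-- The submodule `ψ_p(k)` of `Λe`, generated by the elements `α p_m - ∑ k_i(α, p_m) p_i`, for the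
detours `(α, p_m)` on `p`, and the non-routes on `p`. -/
noncomputable def psi (p : PathThrough I S) (k : p.Coord → K) :
    Submodule (QuiverAlgebra I) (proj I (S 0)) :=
  Submodule.span (QuiverAlgebra I)
    ({x | ∃ d : Detour p, x = projPath I d.path - d.combination k} ∪
      {x | ∃ (b : V) (q : Quiver.Path (S 0) b), ¬ IsRoute S q ∧ x = projPath I q})

/-- The subspace `A_p` of `Λe` spanned by the right subpaths of `p`. -/
noncomputable def pathSpan (p : PathThrough I S) : Submodule K (proj I (S 0)) :=
  Submodule.span K (Set.range fun i => projPath I (p.sub i))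

variable (I S)

/-- The number `m = dim Λe - (l + 1)`; there is no truncation if there is a path through `S`
outside `I`, since then the right subpaths of such a path are linearly independent. -/
noncomputable def kernelDim : ℕ := Module.finrank K (proj I (S 0)) - (l + 1)

/-- The points of `𝒢-Uni(S)`: the `m`-dimensional subspaces of `Λe` which are `Λ`-submodules and
complement `A_p` for some path `p` through `S`. -/
def gUniSet : Set (Gr K (proj I (S 0)) (kernelDim I S)) :=
  {C | (∀ (a : QuiverAlgebra I), ∀ x ∈ C.1, a • x ∈ C.1) ∧
    ∃ p : PathThrough I S, IsCompl C.1 (pathSpan p)}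

/-- The variety `𝒢-Uni(S)`. -/
noncomputable def gUni : SpaceWithFunctions K (gUniSet I S) :=
  (Gr.grassmannian K (proj I (S 0)) (kernelDim I S)).induce (gUniSet I S)

variable {I S}

/-- The closure in `𝒢-Uni(S)` of the image of a subset of `V_p` under `ψ_p`. -/
def patchClosure (p : PathThrough I S) (D : Set (uniserialSet p)) : Set (gUniSet I S) :=
  (gUni I S).cl {C | ∃ k ∈ D, C.1.1 = (psi p k.1).restrictScalars K}

variable (I S)

/-- The collection of the irreducible components of the varieties `V_p`, where `p` traces the paths
through `S`, as patches of `𝒢-Uni(S)`: a component is represented by the closure of its image,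
so that two components are identified if their images have the same closure. -/
def PatchComponents : Set (Set (gUniSet I S)) :=
  {Z | ∃ p : PathThrough I S, ∃ D ∈ (uniserialVariety p).components, Z = patchClosure p D}

end QuiverAlgebra

end Uniserial

/-!
The points of `𝒢-Uni(S)` are the submodules `C` of `Λe` for which `Λe / C` is uniserial with
composition series `S`, and this description does not refer to the presentation of `Λ`. The proof
consists in making this precise by means of flags: a submodule `C` complements the span of the right
subpaths of some path through `S` if and only if there is a filtration
`Λe = L 0 ⊇ ⋯ ⊇ L (l + 1) = C` whose factors are one-dimensional and belong to the vertices
`S 0, …, S l`, and in which the radical does not map `L i` into `L (i + 2)`. One direction takes the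
radical filtration of `Λe / C`, whose factors have dimension one by Nakayama's lemma and a
comparison of dimensions (`isFlag_radFlag`); in the other one the arrows of the path are read off
from the action of the radical on the filtration (`IsFlag.exists_pathThrough`). Simple modules are
distinguished by the characters of `Λ` attached to the vertices, which correspond to each other
under `f` (`vertexChar_apply_of_simple`).

The map `x ↦ f(x) e'` from `Λe` to `Λ'e'` is bijective because `f(e) e'` and `e'` agree modulo the
radical (`projMap_bijective`). It induces an isomorphism of Grassmannians, which restricts to the
isomorphism `gUniIso` of the varieties of uniserial modules.

The patches are related to `𝒢-Uni(S)` by the isomorphism `psiIso` between `V_p` and the open subset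
`cell p` of the points of `𝒢-Uni(S)` which complement the right subpaths of `p`. Every element of
`Λe` is a combination of these subpaths modulo `ψ_p(k)`, with coefficients polynomial in `k`
(`exists_polyFun`); this yields bases of `ψ_p(k)` which depend polynomially on `k`. Conversely, the
coefficients modulo `C` are quotients of Plücker coordinates of `C` by Cramer's rule
(`Gr.IsFrame.detForm_update`). Since the cells form an open cover of `𝒢-Uni(S)`, the closures of the
components of the `V_p` are the irreducible components of `𝒢-Uni(S)` (`patchComponents_eq`), which
correspond to each other under an isomorphism. Partners are birationally equivalent since both are
isomorphic to nonempty open subsets of the same irreducible set, and these overlap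
(`SpaceWithFunctions.birational_of_charts`).
-/

/-! ### Morphisms of spaces with functions -/

namespace SpaceWithFunctions

variable {K X Y Z : Type*}

/-- Regularity of functions is a local property, as for a sheaf of functions. The definition of
`SpaceWithFunctions` does not include this condition. -/
structure IsSheaf (A : SpaceWithFunctions K X) : Prop where
  glue : ∀ (U : Set X) (f : X → K), A.top.IsOpen U →
    (∀ x ∈ U, ∃ N, A.top.IsOpen N ∧ x ∈ N ∧ ∃ g, A.IsRegular N g ∧ ∀ y ∈ N, y ∈ U → f y = g y) →
    A.IsRegular U f

/-- Morphisms: continuous maps under which regular functions on open sets pull back to regular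
functions. -/
structure IsMor (A : SpaceWithFunctions K X) (B : SpaceWithFunctions K Y) (h : X → Y) : Prop where
  isOpen_preimage : ∀ U, B.top.IsOpen U → A.top.IsOpen (h ⁻¹' U)
  isRegular_comp : ∀ U, B.top.IsOpen U → ∀ f, B.IsRegular U f → A.IsRegular (h ⁻¹' U) (f ∘ h)

variable {A : SpaceWithFunctions K X} {B : SpaceWithFunctions K Y} {C : SpaceWithFunctions K Z}

theorem IsMor.comp {g : Y → Z} {h : X → Y} (hg : IsMor B C g) (hh : IsMor A B h) :
    IsMor A C (g ∘ h) where
  isOpen_preimage U hU := hh.isOpen_preimage _ (hg.isOpen_preimage U hU)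
  isRegular_comp U hU f hf :=
    hh.isRegular_comp _ (hg.isOpen_preimage U hU) _ (hg.isRegular_comp U hU f hf)

theorem isMor_val (A : SpaceWithFunctions K X) (T : Set X) :
    IsMor (A.induce T) A (Subtype.val : T → X) where
  isOpen_preimage U hU := ⟨U, hU, rfl⟩
  isRegular_comp U hU f hf _ hx := ⟨U, hU, hx, f, hf, fun _ _ _ => rfl⟩

/-- The restriction of a regular function to a smaller open set is regular. -/
def Restricts (A : SpaceWithFunctions K X) : Prop :=
  ∀ (U N : Set X) (f : X → K), A.top.IsOpen N → N ⊆ U → A.IsRegular U f → A.IsRegular N f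

theorem restricts_induce (A : SpaceWithFunctions K X) (T : Set X) : (A.induce T).Restricts := by
  intro U N f _ hNU hf x hx
  obtain ⟨M, hM, hxM, g, hg, h⟩ := hf x (hNU hx)
  exact ⟨M, hM, hxM, g, hg, fun y hy hyN => h y hy (hNU hyN)⟩

/-- On a subset, regularity is defined by local extension to the ambient space, whence it is a local
property. -/
theorem Restricts.isSheaf_induce (hA : A.Restricts) (T : Set X) : (A.induce T).IsSheaf where
  glue U f hU h x hx := by
    obtain ⟨N, ⟨N', hN', rfl⟩, hxN, g, hg, hfg⟩ := h x hx
    obtain ⟨M, hM, hxM, g', hg', h'⟩ := hg x hxN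
    refine ⟨N' ∩ M, A.top.isOpen_inter _ _ hN' hM, ⟨hxN, hxM⟩, g',
      hA M _ g' (A.top.isOpen_inter _ _ hN' hM) Set.inter_subset_right hg', ?_⟩
    rintro y ⟨hy1, hy2⟩ hyU
    rw [hfg y hy1 hyU, h' y hy2 hy1]

/-- A map to a subset is a morphism if it is a morphism to the ambient space. -/
theorem isMor_of_val (hA : A.IsSheaf) {T : Set Y} {h : X → T}
    (hh : IsMor A B (fun x => (h x : Y))) : IsMor A (B.induce T) h := by
  have hopen : ∀ U, (B.induce T).top.IsOpen U → A.top.IsOpen (h ⁻¹' U) := by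
    rintro _ ⟨U, hU, rfl⟩
    exact hh.isOpen_preimage U hU
  refine ⟨hopen, fun U hU f hf => hA.glue _ _ (hopen U hU) fun x hx => ?_⟩
  obtain ⟨N, hN, hxN, g, hg, hfg⟩ := hf (h x) hx
  exact ⟨_, hh.isOpen_preimage N hN, hxN, _, hh.isRegular_comp N hN g hg,
    fun y hy hyU => hfg (h y) hy hyU⟩

/-- Two mutually inverse morphisms form an isomorphism. -/
def Iso.ofMor (e : X ≃ Y) (h : IsMor A B e) (h' : IsMor B A e.symm) : A.Iso B where
  toEquiv := e
  isOpen_iff U := by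
    refine ⟨h.isOpen_preimage U, fun hU => ?_⟩
    have := h'.isOpen_preimage _ hU
    rwa [show e.symm ⁻¹' (e.toFun ⁻¹' U) = U from e.symm_preimage_preimage U] at this
  isRegular_iff U hU f := by
    refine ⟨h.isRegular_comp U hU f, fun hf => ?_⟩
    have := h'.isRegular_comp _ (h.isOpen_preimage U hU) _ hf
    rw [show e.symm ⁻¹' (e ⁻¹' U) = U from e.symm_preimage_preimage U] at this
    convert this using 1
    ext y
    simp

theorem Iso.isMor (e : A.Iso B) : IsMor A B e.toEquiv where
  isOpen_preimage U hU := (e.isOpen_iff U).1 hU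
  isRegular_comp U hU f hf := (e.isRegular_iff U hU f).1 hf

theorem Iso.isMor_symm (e : A.Iso B) : IsMor B A e.toEquiv.symm := by
  have key : ∀ U : Set X, e.toFun ⁻¹' (e.toEquiv.symm ⁻¹' U) = U :=
    fun U => e.toEquiv.preimage_symm_preimage U
  have hopen : ∀ U, A.top.IsOpen U → B.top.IsOpen (e.toEquiv.symm ⁻¹' U) := fun U hU => by
    rw [e.isOpen_iff, key]
    exact hU
  refine ⟨hopen, fun U hU f hf => ?_⟩
  rw [e.isRegular_iff _ (hopen U hU), key]
  convert hf using 1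
  ext x
  simp

end SpaceWithFunctions

/-! ### Irreducible components and open embeddings -/

section OpenEmbedding

variable {X Y : Type*} [TopologicalSpace X] [TopologicalSpace Y] {j : Y → X}

open Topology

theorem Topology.IsOpenEmbedding.preimage_closure_image (hj : IsOpenEmbedding j) {D : Set Y}
    (hD : IsClosed D) : j ⁻¹' closure (j '' D) = D := by
  rw [← hj.isInducing.closure_eq_preimage_closure_image, hD.closure_eq]

/-- An irreducible closed set which meets the image of an open embedding is the closure of the part
of it lying in the image. -/
theorem Topology.IsOpenEmbedding.closure_image_preimage (hj : IsOpenEmbedding j) {Z : Set X}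
    (hZ : IsIrreducible Z) (hZc : IsClosed Z) (h : (j ⁻¹' Z).Nonempty) :
    closure (j '' (j ⁻¹' Z)) = Z := by
  rw [Set.image_preimage_eq_inter_range]
  refine subset_antisymm (closure_minimal Set.inter_subset_left hZc) ?_
  obtain ⟨y, hy⟩ := h
  exact subset_closure_inter_of_isPreirreducible_of_isOpen hZ.2 hj.isOpen_range ⟨j y, hy, y, rfl⟩

theorem Topology.IsOpenEmbedding.isIrreducible_preimage (hj : IsOpenEmbedding j) {Z : Set X}
    (hZ : IsIrreducible Z) (h : (j ⁻¹' Z).Nonempty) : IsIrreducible (j ⁻¹' Z) :=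
  ⟨h, hZ.2.preimage hj⟩

/-- The closure of the image of a component under an open embedding is a component. -/
theorem Topology.IsOpenEmbedding.closure_image_mem_irreducibleComponents (hj : IsOpenEmbedding j)
    {D : Set Y} (hD : D ∈ irreducibleComponents Y) :
    closure (j '' D) ∈ irreducibleComponents X := by
  have hDi : IsIrreducible D := hD.1
  refine ⟨(hDi.image j hj.continuous.continuousOn).closure, fun Z hZ hle => ?_⟩
  have hsub : D ⊆ j ⁻¹' closure Z := fun y hy =>
    subset_closure (hle (subset_closure ⟨y, hy, rfl⟩))
  have hne : (j ⁻¹' closure Z).Nonempty := hDi.1.mono hsub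
  have heq : j ⁻¹' closure Z = D :=
    subset_antisymm (hD.2 (hj.isIrreducible_preimage hZ.closure hne) hsub) hsub
  have := hj.closure_image_preimage hZ.closure isClosed_closure hne
  rw [heq] at this
  rw [this]
  exact subset_closure

/-- The trace of a component on the image of an open embedding is a component, if it is not
empty. -/
theorem Topology.IsOpenEmbedding.preimage_mem_irreducibleComponents (hj : IsOpenEmbedding j)
    {Z : Set X} (hZ : Z ∈ irreducibleComponents X) (h : (j ⁻¹' Z).Nonempty) :
    j ⁻¹' Z ∈ irreducibleComponents Y := by
  refine ⟨hj.isIrreducible_preimage hZ.1 h, fun D hD hle => ?_⟩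
  have h1 : closure (j '' D) ≤ Z := by
    refine hZ.2 (hD.image j hj.continuous.continuousOn).closure ?_
    rw [← hj.closure_image_preimage hZ.1 (isClosed_of_mem_irreducibleComponents Z hZ) h]
    exact closure_mono (Set.image_mono hle)
  exact fun y hy => h1 (subset_closure ⟨y, hy, rfl⟩)

end OpenEmbedding

/-! ### The Grassmannian -/

namespace Gr

open SpaceWithFunctions

variable {K : Type*} [Field K] {W : Type*} [AddCommGroup W] [Module K W] {m : ℕ}

theorem restricts_grassmannian : (grassmannian K W m).Restricts := by
  intro U N f _ hNU hf D hD
  obtain ⟨d, F, G, hF, hG, hv, h⟩ := hf D (hNU hD)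
  exact ⟨d, F, G, hF, hG, hv, fun E hE => h E (hNU hE)⟩

theorem exists_isFrame [FiniteDimensional K W] (D : Gr K W m) : ∃ v, IsFrame D v := by
  let b := Module.finBasisOfFinrankEq K D.1 D.2
  refine ⟨fun i => (b i : W), b.linearIndependent.map' D.1.subtype D.1.ker_subtype, ?_⟩
  have : (Set.range fun i => (b i : W)) = D.1.subtype '' Set.range b := by
    rw [← Set.range_comp]; rfl
  rw [this, ← Submodule.map_span, b.span_eq, Submodule.map_top, Submodule.range_subtype]

/-- The Plücker vectors of two bases of the same subspace are proportional. -/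
theorem IsFrame.exists_scalar {D : Gr K W m} {v v' : Fin m → W} (hv : IsFrame D v)
    (hv' : IsFrame D v') : ∃ c : K, c ≠ 0 ∧ ∀ ω : W [⋀^Fin m]→ₗ[K] K, ω v' = c * ω v := by
  obtain ⟨D, hD⟩ := D
  obtain ⟨hi, rfl : _ = D⟩ := hv
  let b := Module.Basis.span hi
  have hbv : ∀ i, (b i : W) = v i := fun i =>
    congrArg Subtype.val (Module.Basis.span_apply hi i)
  have hmem : ∀ i, v' i ∈ Submodule.span K (Set.range v) := fun i => by
    have : v' i ∈ Submodule.span K (Set.range v') := Submodule.subset_span ⟨i, rfl⟩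
    rwa [hv'.2] at this
  let u : Fin m → Submodule.span K (Set.range v) := fun i => ⟨v' i, hmem i⟩
  have key : ∀ ω : W [⋀^Fin m]→ₗ[K] K, ω v' = b.det u * ω v := fun ω => by
    have h := congrArg (fun η => η u)
      ((ω.compLinearMap (Submodule.subtype _)).eq_smul_basis_det b)
    simp only [AlternatingMap.compLinearMap_apply, AlternatingMap.smul_apply, smul_eq_mul] at h
    rw [mul_comm]
    change ω v' = ω (fun i => (b i : W)) * _ at h
    rw [show (fun i => (b i : W)) = v from funext hbv] at h
    exact h
  refine ⟨b.det u, IsUnit.ne_zero ?_, key⟩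
  rw [← Module.Basis.is_basis_iff_det]
  have hu : LinearIndependent K u :=
    LinearIndependent.of_comp (Submodule.subtype _) hv'.1
  have : FiniteDimensional K (Submodule.span K (Set.range v)) := b.finiteDimensional_of_finite
  refine ⟨hu, hu.span_eq_top_of_card_eq_finrank' ?_⟩
  rw [hD, Fintype.card_fin]

theorem pluckerEval_smul {v v' : Fin m → W} {c : K}
    (h : ∀ ω : W [⋀^Fin m]→ₗ[K] K, ω v' = c * ω v) {d : ℕ}
    {F : MvPolynomial (W [⋀^Fin m]→ₗ[K] K) K} (hF : F.IsHomogeneous d) :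
    pluckerEval v' F = c ^ d * pluckerEval v F := by
  rw [pluckerEval, pluckerEval, MvPolynomial.eval_eq, MvPolynomial.eval_eq, Finset.mul_sum]
  refine Finset.sum_congr rfl fun s hs => ?_
  simp only [h, mul_pow, Finset.prod_mul_distrib]
  rw [Finset.prod_pow_eq_pow_sum, ← hF.degree_eq_sum_deg_support hs]
  ring

theorem IsFrame.pluckerEval_ne_zero {D : Gr K W m} {v v' : Fin m → W} (hv : IsFrame D v)
    (hv' : IsFrame D v') {d : ℕ} {F : MvPolynomial (W [⋀^Fin m]→ₗ[K] K) K}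
    (hF : F.IsHomogeneous d) (h : pluckerEval v F ≠ 0) : pluckerEval v' F ≠ 0 := by
  obtain ⟨c, hc, hcv⟩ := hv.exists_scalar hv'
  rw [pluckerEval_smul hcv hF]
  exact mul_ne_zero (pow_ne_zero _ hc) h

theorem IsFrame.pluckerEval_div {D : Gr K W m} {v v' : Fin m → W} (hv : IsFrame D v)
    (hv' : IsFrame D v') {d : ℕ} {F G : MvPolynomial (W [⋀^Fin m]→ₗ[K] K) K}
    (hF : F.IsHomogeneous d) (hG : G.IsHomogeneous d) :
    pluckerEval v' F / pluckerEval v' G = pluckerEval v F / pluckerEval v G := by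
  obtain ⟨c, hc, hcv⟩ := hv.exists_scalar hv'
  rw [pluckerEval_smul hcv hF, pluckerEval_smul hcv hG, mul_div_mul_left _ _ (pow_ne_zero _ hc)]

theorem isOpen_basic {d : ℕ} {F : MvPolynomial (W [⋀^Fin m]→ₗ[K] K) K} (hF : F.IsHomogeneous d) :
    (grassmannian K W m).top.IsOpen {D | ∃ v, IsFrame D v ∧ pluckerEval v F ≠ 0} :=
  TopologicalSpace.isOpen_generateFrom_of_mem ⟨d, F, hF, rfl⟩

section ratio

variable [FiniteDimensional K W]

/-- The quotient of two polynomials in the Plücker coordinates, as a function on the Grassmannian;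
it is well defined if both are homogeneous of the same degree. -/
noncomputable def ratio (F G : MvPolynomial (W [⋀^Fin m]→ₗ[K] K) K) (D : Gr K W m) : K :=
  pluckerEval (exists_isFrame D).choose F / pluckerEval (exists_isFrame D).choose G

variable {d : ℕ} {F G : MvPolynomial (W [⋀^Fin m]→ₗ[K] K) K}

theorem IsFrame.ratio_eq (hF : F.IsHomogeneous d) (hG : G.IsHomogeneous d) {D : Gr K W m}
    {v : Fin m → W} (hv : IsFrame D v) : ratio F G D = pluckerEval v F / pluckerEval v G :=
  hv.pluckerEval_div (exists_isFrame D).choose_spec hF hG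

theorem isRegular_ratio (hF : F.IsHomogeneous d) (hG : G.IsHomogeneous d) :
    (grassmannian K W m).IsRegular {D | ∃ v, IsFrame D v ∧ pluckerEval v G ≠ 0} (ratio F G) :=
  fun _ hD => ⟨d, F, G, hF, hG, hD, fun _ _ _ hv _ => hv.ratio_eq hF hG⟩

end ratio

section map

variable {W' : Type*} [AddCommGroup W'] [Module K W'] {m' : ℕ}

/-- The map of Grassmannians induced by an isomorphism of vector spaces. -/
def map (T : W ≃ₗ[K] W') (hm : m = m') (D : Gr K W m) : Gr K W' m' :=
  ⟨D.1.map (T : W →ₗ[K] W'), by rw [LinearEquiv.finrank_map_eq, D.2, hm]⟩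

theorem isFrame_map (T : W ≃ₗ[K] W') {D : Gr K W m} {v : Fin m → W} (hv : IsFrame D v) :
    IsFrame (map T rfl D) (T ∘ v) := by
  refine ⟨hv.1.map' _ T.ker, ?_⟩
  rw [Set.range_comp]
  change Submodule.span K ((T : W →ₗ[K] W') '' _) = Submodule.map (T : W →ₗ[K] W') D.1
  rw [← Submodule.map_span, hv.2]

theorem IsFrame.of_map (T : W ≃ₗ[K] W') {D : Gr K W m} {v : Fin m → W'}
    (hv : IsFrame (map T rfl D) v) : IsFrame D (T.symm ∘ v) := by
  refine ⟨hv.1.map' _ T.symm.ker, ?_⟩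
  have h : Submodule.span K (Set.range v) = D.1.map (T : W →ₗ[K] W') := hv.2
  rw [Set.range_comp]
  change Submodule.span K ((T.symm : W' →ₗ[K] W) '' _) = D.1
  rw [← Submodule.map_span, h, ← Submodule.map_comp]
  simp

/-- The polynomial in the Plücker coordinates obtained by composition with a linear
isomorphism. -/
noncomputable def pullback (T : W ≃ₗ[K] W') (F : MvPolynomial (W' [⋀^Fin m]→ₗ[K] K) K) :
    MvPolynomial (W [⋀^Fin m]→ₗ[K] K) K :=
  MvPolynomial.rename (fun ω => ω.compLinearMap (T : W →ₗ[K] W')) F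

theorem pluckerEval_pullback (T : W ≃ₗ[K] W') (F : MvPolynomial (W' [⋀^Fin m]→ₗ[K] K) K)
    (v : Fin m → W) : pluckerEval v (pullback T F) = pluckerEval (T ∘ v) F := by
  rw [pluckerEval, pullback, MvPolynomial.eval_rename]
  rfl

theorem isMor_map (T : W ≃ₗ[K] W') (hm : m = m') :
    IsMor (grassmannian K W m) (grassmannian K W' m') (map T hm) := by
  subst hm
  have hopen : ∀ F : MvPolynomial (W' [⋀^Fin m]→ₗ[K] K) K, ∀ D : Gr K W m,
      (∃ v, IsFrame (map T rfl D) v ∧ pluckerEval v F ≠ 0) →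
        ∃ v, IsFrame D v ∧ pluckerEval v (pullback T F) ≠ 0 := by
    rintro F D ⟨v, hv, h⟩
    refine ⟨_, hv.of_map, ?_⟩
    rw [pluckerEval_pullback]
    convert h using 2
    ext i
    simp
  refine ⟨fun U hU => ?_, fun U hU f hf D hD => ?_⟩
  · let := (grassmannian K W m).top
    let := (grassmannian K W' m).top
    refine (continuous_generateFrom_iff.2 ?_ : Continuous (map T rfl)).isOpen_preimage U hU
    rintro _ ⟨d, F, hF, rfl⟩
    have hF' : (pullback T F).IsHomogeneous d := hF.rename_isHomogeneous
    have hset : map T rfl ⁻¹' {D | ∃ v, IsFrame D v ∧ pluckerEval v F ≠ 0} =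
        {D | ∃ v, IsFrame D v ∧ pluckerEval v (pullback T F) ≠ 0} := by
      ext D
      refine ⟨hopen F D, ?_⟩
      rintro ⟨v, hv, h⟩
      exact ⟨_, isFrame_map T hv, by rwa [← pluckerEval_pullback]⟩
    rw [hset]
    exact isOpen_basic hF'
  · obtain ⟨d, F, G, hF, hG, hv, h⟩ := hf _ hD
    refine ⟨d, pullback T F, pullback T G, hF.rename_isHomogeneous, hG.rename_isHomogeneous,
      hopen G D hv, fun E hE v hv hne => ?_⟩
    rw [pluckerEval_pullback, pluckerEval_pullback]
    rw [pluckerEval_pullback] at hne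
    exact h _ hE _ (isFrame_map T hv) hne

end map

section detForm

variable {ι : Type*} [Fintype ι] [DecidableEq ι]

/-- The Plücker coordinate `v ↦ det (q, v)`, for a fixed family `q`. -/
noncomputable def detForm (b : Module.Basis (ι ⊕ Fin m) K W) (q : ι → W) : W [⋀^Fin m]→ₗ[K] K where
  toFun v := b.det (Sum.elim q v)
  map_update_add' v i x y := by
    have h : ∀ z, Sum.elim q (Function.update v i z) =
        Function.update (Sum.elim q v) (Sum.inr i) z := fun z => by
      ext (j | j)
      · simp
      · by_cases hj : j = i
        · subst hj; simp
        · simp [hj]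
    simp only [h, AlternatingMap.map_update_add]
  map_update_smul' v i c x := by
    have h : ∀ z, Sum.elim q (Function.update v i z) =
        Function.update (Sum.elim q v) (Sum.inr i) z := fun z => by
      ext (j | j)
      · simp
      · by_cases hj : j = i
        · subst hj; simp
        · simp [hj]
    simp only [h, AlternatingMap.map_update_smul]
  map_eq_zero_of_eq' v i j h hij :=
    b.det.map_eq_zero_of_eq _ (i := Sum.inr i) (j := Sum.inr j) h (by simpa using hij)

theorem detForm_apply (b : Module.Basis (ι ⊕ Fin m) K W) (q : ι → W) (v : Fin m → W) :
    detForm b q v = b.det (Sum.elim q v) := rfl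

/-- A subspace of the appropriate dimension complements the span of `q` if and only if the Plücker
coordinate given by `q` does not vanish. -/
theorem IsFrame.isCompl_iff (b : Module.Basis (ι ⊕ Fin m) K W) (q : ι → W) {C : Gr K W m}
    {v : Fin m → W} (hv : IsFrame C v) :
    IsCompl C.1 (Submodule.span K (Set.range q)) ↔ detForm b q v ≠ 0 := by
  have : FiniteDimensional K W := b.finiteDimensional_of_finite
  rw [detForm_apply, ← isUnit_iff_ne_zero, ← Module.Basis.is_basis_iff_det]
  have hspan : Submodule.span K (Set.range (Sum.elim q v)) =
      Submodule.span K (Set.range q) ⊔ C.1 := by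
    rw [Set.Sum.elim_range, Submodule.span_union, hv.2]
  rw [hspan]
  constructor
  · intro h
    have htop : Submodule.span K (Set.range q) ⊔ C.1 = ⊤ := by rw [sup_comm]; exact h.sup_eq_top
    refine ⟨linearIndependent_of_top_le_span_of_card_eq_finrank ?_
      (Module.finrank_eq_card_basis b).symm, htop⟩
    rw [hspan, htop]
  · rintro ⟨hi, htop⟩
    refine ⟨?_, codisjoint_iff.2 (by rw [sup_comm]; exact htop)⟩
    have h := (linearIndependent_sum.1 hi).2.2
    simp only [Sum.elim_comp_inl, Sum.elim_comp_inr] at h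
    rw [hv.2] at h
    exact h.symm

/-- Cramer's rule for the coordinates of a vector modulo a subspace. -/
theorem IsFrame.detForm_update (b : Module.Basis (ι ⊕ Fin m) K W) (q : ι → W) {C : Gr K W m}
    {v : Fin m → W} (hv : IsFrame C v) {w : W} {c : ι → K} (h : w - ∑ i, c i • q i ∈ C.1) (i : ι) :
    detForm b (Function.update q i w) v = c i * detForm b q v := by
  simp only [detForm_apply]
  rw [← hv.2, Submodule.mem_span_range_iff_exists_fun] at h
  obtain ⟨a, ha⟩ := h
  have hw : w = ∑ j : ι ⊕ Fin m, Sum.elim c a j • Sum.elim q v j := by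
    rw [Fintype.sum_sum_type]
    simp only [Sum.elim_inl, Sum.elim_inr]
    rw [ha, add_sub_cancel]
  have hup : Sum.elim (Function.update q i w) v =
      Function.update (Sum.elim q v) (Sum.inl i) w := by
    ext (j | j)
    · by_cases hj : j = i
      · subst hj; simp
      · simp [hj]
    · simp
  rw [hup]
  conv_lhs => rw [hw]
  -- Only the multiple of `q i` contributes: the other terms repeat an argument.
  rw [AlternatingMap.map_update_sum, Finset.sum_eq_single (Sum.inl i)]
  · rw [AlternatingMap.map_update_smul, Function.update_eq_self]
    rfl
  · intro j _ hj
    rw [AlternatingMap.map_update_smul, AlternatingMap.map_update_self _ _ hj.symm, smul_zero]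
  · exact fun h => absurd (Finset.mem_univ _) h

end detForm

end Gr

/-! ### Affine space and morphisms to and from the Grassmannian -/

section Affine

open SpaceWithFunctions

variable {K : Type*} [Field K] {κ : Type*}

theorem restricts_affineSpace : (affineSpace K κ).Restricts := by
  intro U N f _ hNU hf x hx
  obtain ⟨F, G, hG, h⟩ := hf x (hNU hx)
  exact ⟨F, G, hG, fun y hy => h y (hNU hy)⟩

/-- The algebra of polynomial functions on affine space. -/
noncomputable def polyFun (K : Type*) [Field K] (κ : Type*) : Subalgebra K ((κ → K) → K) :=
  (AlgHom.pi fun k => MvPolynomial.aeval k).range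

theorem mem_polyFun {g : (κ → K) → K} :
    g ∈ polyFun K κ ↔ ∃ P : MvPolynomial κ K, ∀ k, g k = MvPolynomial.eval k P := by
  constructor
  · rintro ⟨P, rfl⟩
    exact ⟨P, fun k => by simp [MvPolynomial.aeval_eq_eval]⟩
  · rintro ⟨P, hP⟩
    exact ⟨P, funext fun k => by simp [hP, MvPolynomial.aeval_eq_eval]⟩

theorem const_mem_polyFun (c : K) : (fun _ : κ → K => c) ∈ polyFun K κ :=
  mem_polyFun.2 ⟨MvPolynomial.C c, by simp⟩

theorem coord_mem_polyFun (i : κ) : (fun k : κ → K => k i) ∈ polyFun K κ :=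
  mem_polyFun.2 ⟨MvPolynomial.X i, by simp⟩

theorem sum_mem_polyFun {β : Type*} (s : Finset β) {g : β → (κ → K) → K}
    (hg : ∀ i ∈ s, g i ∈ polyFun K κ) : (fun k => ∑ i ∈ s, g i k) ∈ polyFun K κ := by
  convert sum_mem hg using 1
  ext k
  simp

theorem mul_mem_polyFun {g h : (κ → K) → K} (hg : g ∈ polyFun K κ) (hh : h ∈ polyFun K κ) :
    (fun k => g k * h k) ∈ polyFun K κ := mul_mem hg hh

theorem prod_mem_polyFun {β : Type*} (s : Finset β) {g : β → (κ → K) → K}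
    (hg : ∀ i ∈ s, g i ∈ polyFun K κ) : (fun k => ∏ i ∈ s, g i k) ∈ polyFun K κ := by
  convert prod_mem hg using 1
  ext k
  simp

variable {W : Type*} [AddCommGroup W] [Module K W] {m : ℕ}

theorem alternatingMap_mem_polyFun {β : Type*} [Fintype β] (b : Module.Basis β K W)
    {v : (κ → K) → Fin m → W} (hv : ∀ j i, (fun k => b.repr (v k j) i) ∈ polyFun K κ)
    (ω : W [⋀^Fin m]→ₗ[K] K) : (fun k => ω (v k)) ∈ polyFun K κ := by
  classical
  have h : ∀ k, ω (v k) =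
      ∑ r : Fin m → β, (∏ j, b.repr (v k j) (r j)) * ω fun j => b (r j) := fun k => by
    conv_lhs => rw [show v k = fun j => ∑ i, b.repr (v k j) i • b i from
      funext fun j => (b.sum_repr _).symm]
    change ω.toMultilinearMap _ = _
    rw [MultilinearMap.map_sum]
    refine Finset.sum_congr rfl fun r _ => ?_
    rw [MultilinearMap.map_smul_univ]
    rfl
  simp only [h]
  exact sum_mem_polyFun _ fun r _ =>
    mul_mem_polyFun (prod_mem_polyFun _ fun j _ => hv j (r j)) (const_mem_polyFun _)

/-- A map from a subvariety of affine space to the Grassmannian is a morphism if its values have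
bases which depend polynomially on the point. -/
theorem isMor_grassmannian (Y : Set (κ → K)) {h : Y → Gr K W m} {v : (κ → K) → Fin m → W}
    (hv : ∀ y : Y, Gr.IsFrame (h y) (v y))
    (hpoly : ∀ ω : W [⋀^Fin m]→ₗ[K] K, (fun k => ω (v k)) ∈ polyFun K κ) :
    IsMor ((affineSpace K κ).induce Y) (Gr.grassmannian K W m) h := by
  choose P hP using fun ω => mem_polyFun.1 (hpoly ω)
  have hev : ∀ (F : MvPolynomial (W [⋀^Fin m]→ₗ[K] K) K) (k : κ → K),
      MvPolynomial.eval k (MvPolynomial.bind₁ P F) = Gr.pluckerEval (v k) F := fun F k => by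
    rw [← MvPolynomial.aeval_eq_eval, MvPolynomial.aeval_bind₁, Gr.pluckerEval]
    simp only [MvPolynomial.aeval_eq_eval, hP]
  have hbasic : ∀ F : MvPolynomial κ K,
      (affineSpace K κ).top.IsOpen {x | MvPolynomial.eval x F ≠ 0} := fun F =>
    TopologicalSpace.isOpen_generateFrom_of_mem ⟨F, rfl⟩
  refine ⟨fun U hU => ?_, fun U hU f hf y hy => ?_⟩
  · let := ((affineSpace K κ).induce Y).top
    let := (Gr.grassmannian K W m).top
    refine (continuous_generateFrom_iff.2 ?_ : Continuous h).isOpen_preimage U hU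
    rintro _ ⟨d, F, hF, rfl⟩
    refine ⟨_, hbasic (MvPolynomial.bind₁ P F), ?_⟩
    ext y
    simp only [Set.mem_preimage, Set.mem_ofPred_eq, hev]
    refine ⟨fun hne => ⟨_, hv y, hne⟩, ?_⟩
    rintro ⟨v', hv', hne⟩
    exact hv'.pluckerEval_ne_zero (hv y) hF hne
  · obtain ⟨d, F, G, hF, hG, ⟨v', hv', hne⟩, hf'⟩ := hf _ hy
    refine ⟨_, hbasic (MvPolynomial.bind₁ P G), ?_,
      fun k => MvPolynomial.eval k (MvPolynomial.bind₁ P F) /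
        MvPolynomial.eval k (MvPolynomial.bind₁ P G), fun k hk => ⟨_, _, hk, fun _ _ _ => rfl⟩, ?_⟩
    · rw [Set.mem_ofPred_eq, hev]
      exact hv'.pluckerEval_ne_zero (hv y) hG hne
    · intro z hz hzU
      rw [Set.mem_ofPred_eq, hev] at hz
      simp only [hev]
      exact hf' _ hzU _ (hv z) hz

/-- Substituting quotients `ω c / ω₀` of Plücker coordinates into a polynomial and clearing
denominators gives a homogeneous polynomial in the Plücker coordinates. -/
theorem exists_homogenization (ω₀ : W [⋀^Fin m]→ₗ[K] K) (ω : κ → W [⋀^Fin m]→ₗ[K] K)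
    (F : MvPolynomial κ K) : ∃ (d : ℕ) (H : MvPolynomial (W [⋀^Fin m]→ₗ[K] K) K),
      H.IsHomogeneous d ∧ ∀ (v : Fin m → W) (x : κ → K), (∀ c, x c * ω₀ v = ω c v) →
        MvPolynomial.eval x F * ω₀ v ^ d = Gr.pluckerEval v H := by
  induction F using MvPolynomial.induction_on with
  | C a => exact ⟨0, MvPolynomial.C a, MvPolynomial.isHomogeneous_C _ _, by simp [Gr.pluckerEval]⟩
  | add F F' h h' =>
    obtain ⟨d, H, hH, h⟩ := h
    obtain ⟨d', H', hH', h'⟩ := h'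
    refine ⟨d + d', H * MvPolynomial.X ω₀ ^ d' + MvPolynomial.X ω₀ ^ d * H',
      (hH.mul (MvPolynomial.isHomogeneous_X_pow _ _)).add
        ((MvPolynomial.isHomogeneous_X_pow _ _).mul hH'), fun v x hx => ?_⟩
    have e := h v x hx
    have e' := h' v x hx
    simp only [Gr.pluckerEval, map_add, map_mul, map_pow, MvPolynomial.eval_X] at e e' ⊢
    rw [← e, ← e']
    ring
  | mul_X F c h =>
    obtain ⟨d, H, hH, h⟩ := h
    refine ⟨d + 1, H * MvPolynomial.X (ω c), hH.mul (MvPolynomial.isHomogeneous_X _ _),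
      fun v x hx => ?_⟩
    have e := h v x hx
    simp only [Gr.pluckerEval, map_mul, MvPolynomial.eval_X] at e ⊢
    rw [← e, ← hx]
    ring

/-- A map to affine space whose coordinates are quotients of Plücker coordinates, with a
denominator without zeros, is a morphism. -/
theorem isMor_affineSpace [FiniteDimensional K W] {X : Type*} {A : SpaceWithFunctions K X}
    (hA : A.IsSheaf) {i : X → Gr K W m} (hi : IsMor A (Gr.grassmannian K W m) i)
    {θ : X → κ → K} (ω₀ : W [⋀^Fin m]→ₗ[K] K) (ω : κ → W [⋀^Fin m]→ₗ[K] K)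
    (hω₀ : ∀ x v, Gr.IsFrame (i x) v → ω₀ v ≠ 0)
    (hω : ∀ x v, Gr.IsFrame (i x) v → ∀ c, θ x c * ω₀ v = ω c v) :
    IsMor A (affineSpace K κ) θ := by
  choose d H hH hFH using exists_homogenization ω₀ ω
  have hne : ∀ F x v, Gr.IsFrame (i x) v →
      (Gr.pluckerEval v (H F) ≠ 0 ↔ MvPolynomial.eval (θ x) F ≠ 0) := fun F x v hv => by
    rw [← hFH F v (θ x) (hω x v hv)]
    simp [hω₀ x v hv]
  have hopen : ∀ U, (affineSpace K κ).top.IsOpen U → A.top.IsOpen (θ ⁻¹' U) := fun U hU => by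
    let := A.top
    let := (affineSpace K κ).top
    refine (continuous_generateFrom_iff.2 ?_ : Continuous θ).isOpen_preimage U hU
    rintro _ ⟨F, rfl⟩
    convert hi.isOpen_preimage _ (Gr.isOpen_basic (hH F)) using 0
    refine iff_of_eq (congrArg _ ?_)
    ext x
    constructor
    · intro hx
      obtain ⟨v, hv⟩ := Gr.exists_isFrame (i x)
      exact ⟨v, hv, (hne F x v hv).2 hx⟩
    · rintro ⟨v, hv, hx⟩
      exact (hne F x v hv).1 hx
  refine ⟨hopen, fun U hU f hf => hA.glue _ _ (hopen U hU) fun x hx => ?_⟩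
  obtain ⟨F, G, hG, hf⟩ := hf _ hx
  -- Multiplying by powers of `ω₀` brings numerator and denominator to the same degree.
  let F' := H F * MvPolynomial.X ω₀ ^ d G
  let G' := MvPolynomial.X ω₀ ^ d F * H G
  have hF' : F'.IsHomogeneous (d F + d G) := (hH F).mul (MvPolynomial.isHomogeneous_X_pow _ _)
  have hG' : G'.IsHomogeneous (d F + d G) := (MvPolynomial.isHomogeneous_X_pow _ _).mul (hH G)
  have hF'v : ∀ v, Gr.pluckerEval v F' = Gr.pluckerEval v (H F) * ω₀ v ^ d G := fun v => by
    simp [F', Gr.pluckerEval]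
  have hG'v : ∀ v, Gr.pluckerEval v G' = ω₀ v ^ d F * Gr.pluckerEval v (H G) := fun v => by
    simp [G', Gr.pluckerEval]
  refine ⟨_, hi.isOpen_preimage _ (Gr.isOpen_basic hG'), ?_, _,
    hi.isRegular_comp _ (Gr.isOpen_basic hG') _ (Gr.isRegular_ratio hF' hG'), ?_⟩
  · obtain ⟨v, hv⟩ := Gr.exists_isFrame (i x)
    refine ⟨v, hv, ?_⟩
    rw [hG'v]
    exact mul_ne_zero (pow_ne_zero _ (hω₀ x v hv)) ((hne G x v hv).2 hG)
  · rintro y ⟨v, hv, hy⟩ hyU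
    rw [hG'v] at hy
    have hGy := (hne G y v hv).1 (right_ne_zero_of_mul hy)
    have h0 := hω₀ y v hv
    rw [Function.comp_apply, Function.comp_apply, hf _ hyU hGy, hv.ratio_eq hF' hG', hF'v, hG'v,
      ← hFH F v (θ y) (hω y v hv), ← hFH G v (θ y) (hω y v hv)]
    field_simp

end Affine

/-! ### The structure of the algebra of a quiver with admissible relations -/

namespace QuiverAlgebra

section Basics

universe u v w

variable {K : Type u} [Field K] {V : Type v} [Fintype V] [Quiver.{w} V]
variable (I : Ideal (PathAlgebra K V)) [I.IsTwoSided]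

theorem path_mul_path {a b c : V} (q : Quiver.Path b c) (p : Quiver.Path a b) :
    path I q * path I p = path I (p.comp q) := by
  rw [path, path, path, ← map_mul, PathAlgebra.of_mul_of]

theorem path_mul_path_of_ne {a b b' c : V} (q : Quiver.Path b' c) (p : Quiver.Path a b)
    (h : b ≠ b') : path I q * path I p = 0 := by
  rw [path, path, ← map_mul, PathAlgebra.of_mul_of_ne _ _ _ h, map_zero]

theorem path_cons {a b c : V} (p : Quiver.Path a b) (α : b ⟶ c) :
    path I (p.cons α) = path I α.toPath * path I p := by
  rw [path_mul_path]
  rfl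

theorem idem_mul_path {a b : V} (q : Quiver.Path a b) : idem I b * path I q = path I q := by
  rw [idem, path_mul_path, Quiver.Path.comp_nil]

theorem idem_mul_idem (a : V) : idem I a * idem I a = idem I a := path_mul_idem I _

theorem idem_mul_path_of_ne {a b c : V} (q : Quiver.Path a b) (h : b ≠ c) :
    idem I c * path I q = 0 := path_mul_path_of_ne I _ _ h

theorem path_mul_idem_of_ne {a b c : V} (q : Quiver.Path a b) (h : c ≠ a) :
    path I q * idem I c = 0 := path_mul_path_of_ne I _ _ h

theorem mk_smul (c : K) (x : PathAlgebra K V) :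
    Ideal.Quotient.mk I (c • x) = c • Ideal.Quotient.mk I x := rfl

theorem path_eq_zero {a b : V} {q : Quiver.Path a b} :
    path I q = 0 ↔ PathAlgebra.of K q ∈ I := Ideal.Quotient.eq_zero_iff_mem

/-- The residue classes of the paths span `Λ`. -/
theorem span_path : Submodule.span K (Set.range fun q : AnyPath V => path I q.2.2) = ⊤ := by
  rw [eq_top_iff]
  rintro x -
  obtain ⟨x, rfl⟩ := Ideal.Quotient.mk_surjective x
  induction x using PathAlgebra.induction_on with
  | h0 => rw [map_zero]; exact zero_mem _
  | hadd x y hx hy => rw [map_add]; exact add_mem hx hy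
  | hof c p =>
    rw [mk_smul]
    exact Submodule.smul_mem _ _ (Submodule.subset_span ⟨p.toAny, rfl⟩)

@[elab_as_elim]
theorem path_induction {P : QuiverAlgebra I → Prop} (x : QuiverAlgebra I) (h0 : P 0)
    (hadd : ∀ x y, P x → P y → P (x + y)) (hsmul : ∀ (c : K) x, P x → P (c • x))
    (hpath : ∀ {a b : V} (p : Quiver.Path a b), P (path I p)) : P x := by
  have hx : x ∈ Submodule.span K (Set.range fun q : AnyPath V => path I q.2.2) := by
    rw [span_path]; trivial
  induction hx using Submodule.span_induction with
  | mem x hx => obtain ⟨q, rfl⟩ := hx; exact hpath _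
  | zero => exact h0
  | add x y _ _ hx hy => exact hadd x y hx hy
  | smul c x _ hx => exact hsmul c x hx

theorem finite_path_of_length [∀ a b : V, Finite (a ⟶ b)] (n : ℕ) :
    Finite {q : AnyPath V // q.2.2.length = n} := by
  induction n with
  | zero =>
    refine Finite.of_surjective
      (fun a : V => ⟨(Quiver.Path.nil : Quiver.Path a a).toAny, rfl⟩) ?_
    rintro ⟨⟨a, b, q⟩, hq⟩
    obtain rfl := Quiver.Path.eq_of_length_zero q hq
    cases q with
    | nil => exact ⟨a, rfl⟩
    | cons q α => simp at hq
  | succ n ih =>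
    refine Finite.of_surjective
      (fun x : Σ (q : {q : AnyPath V // q.2.2.length = n}), Σ c : V, (q.1.2.1 ⟶ c) =>
        ⟨(x.1.1.2.2.cons x.2.2).toAny, by simp [x.1.2]⟩) ?_
    rintro ⟨⟨a, b, q⟩, hq⟩
    cases q with
    | nil => simp at hq
    | cons q α => exact ⟨⟨⟨⟨a, _, q⟩, by simpa using hq⟩, _, α⟩, rfl⟩

variable {I}

theorem finiteDimensional [∀ a b : V, Finite (a ⟶ b)] (hI : PathAlgebra.IsAdmissible I) :
    FiniteDimensional K (QuiverAlgebra I) := by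
  obtain ⟨N, hN⟩ := hI.2
  have : ∀ n, Finite {q : AnyPath V // q.2.2.length = n} := finite_path_of_length
  have hfin : Finite (Σ n : Fin N, {q : AnyPath V // q.2.2.length = n}) := inferInstance
  have hspan : (⊤ : Submodule K (QuiverAlgebra I)) ≤ Submodule.span K
      (Set.range fun x : Σ n : Fin N, {q : AnyPath V // q.2.2.length = n} =>
        path I x.2.1.2.2) := by
    rw [← span_path, Submodule.span_le]
    rintro _ ⟨q, rfl⟩
    by_cases hq : q.2.2.length < N
    · exact Submodule.subset_span ⟨⟨⟨_, hq⟩, q, rfl⟩, rfl⟩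
    · dsimp only
      rw [(path_eq_zero I).2 (hN _ _ _ (not_lt.1 hq))]
      exact zero_mem _
  exact Module.finite_def.2 (top_le_iff.1 hspan ▸ Submodule.fg_span (Set.finite_range _))

open Classical in
/-- The coefficient of the trivial path at a vertex, as a character of the path algebra. -/
noncomputable def pathAlgebraChar (K : Type u) [Field K] (a : V) : PathAlgebra K V →ₐ[K] K :=
  AlgHom.ofLinearMap
    (PathAlgebra.lift K fun q => if q = (Quiver.Path.nil : Quiver.Path a a).toAny then 1 else 0)
    (by
      rw [PathAlgebra.one_def, map_sum, Finset.sum_eq_single a]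
      · rw [PathAlgebra.lift_of, if_pos rfl]
      · intro b _ hb
        rw [PathAlgebra.lift_of, if_neg]
        intro h
        exact hb (congrArg Sigma.fst h)
      · simp)
    (by
      intro x y
      induction x using PathAlgebra.induction_on with
      | h0 => simp
      | hadd x x' h h' => simp only [add_mul, map_add, h, h']
      | @hof c a₁ b₁ q =>
      induction y using PathAlgebra.induction_on with
      | h0 => simp
      | hadd y y' h h' => simp only [mul_add, map_add, h, h']
      | @hof d a₂ b₂ p =>
      rw [PathAlgebra.smul_mul', PathAlgebra.mul_smul']
      simp only [map_smul, smul_eq_mul, PathAlgebra.lift_of]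
      by_cases hb : b₂ = a₁
      · subst hb
        rw [PathAlgebra.of_mul_of, PathAlgebra.lift_of]
        cases q with
        | cons q α =>
          rw [Quiver.Path.comp_cons, if_neg, if_neg (c := _ = _)]
          · ring
          · intro h
            simpa using congrArg (fun q : AnyPath V => q.2.2.length) h
          · intro h
            simpa using congrArg (fun q : AnyPath V => q.2.2.length) h
        | nil =>
          rw [Quiver.Path.comp_nil]
          by_cases hp : p.toAny = (Quiver.Path.nil : Quiver.Path a a).toAny
          · have : _ = a := congrArg (fun q : AnyPath V => q.2.1) hp
            subst this
            rw [if_pos hp, if_pos rfl]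
            ring
          · rw [if_neg hp]
            ring
      · rw [PathAlgebra.of_mul_of_ne _ _ _ hb, map_zero]
        by_cases hp : p.toAny = (Quiver.Path.nil : Quiver.Path a a).toAny
        · have h1 : b₂ = a := congrArg (fun q : AnyPath V => q.2.1) hp
          rw [if_neg (c := q.toAny = _)]
          · ring
          · intro hq
            exact hb (h1.trans (congrArg (fun q : AnyPath V => q.1) hq).symm)
        · rw [if_neg hp]
          ring)

theorem pathAlgebraChar_eq_coeff (a : V) (x : PathAlgebra K V) :
    pathAlgebraChar K a x = PathAlgebra.coeff K x (Quiver.Path.nil : Quiver.Path a a).toAny := by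
  classical
  induction x using PathAlgebra.induction_on with
  | h0 => simp
  | hadd x y h h' => simp only [map_add, h, h', Finsupp.add_apply]
  | hof c p =>
    have h : pathAlgebraChar K a (PathAlgebra.of K p) =
        if p.toAny = (Quiver.Path.nil : Quiver.Path a a).toAny then 1 else 0 :=
      PathAlgebra.lift_of K _ p
    rw [map_smul, map_smul, Finsupp.smul_apply, h, PathAlgebra.of, LinearEquiv.apply_symm_apply,
      Finsupp.single_apply]

/-- The character of `Λ` given by a vertex `a`: the coefficient of the idempotent `idem I a`. It is
the character by which `Λ` acts on the simple module at `a`. -/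
noncomputable def vertexChar (hI : PathAlgebra.IsAdmissible I) (a : V) : QuiverAlgebra I →ₐ[K] K :=
  Ideal.Quotient.liftₐ I (pathAlgebraChar K a) fun x hx => by
    rw [pathAlgebraChar_eq_coeff]
    by_contra h
    have := hI.1 x hx _ (Finsupp.mem_support_iff.2 h)
    simp at this

variable (hI : PathAlgebra.IsAdmissible I)

theorem vertexChar_path (a : V) {b c : V} (q : Quiver.Path b c) :
    vertexChar hI a (path I q) = pathAlgebraChar K a (PathAlgebra.of K q) := rfl

theorem vertexChar_idem_self (a : V) : vertexChar hI a (idem I a) = 1 := by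
  classical
  rw [idem, vertexChar_path, pathAlgebraChar_eq_coeff]
  simp [PathAlgebra.of]

theorem vertexChar_idem_of_ne {a b : V} (h : a ≠ b) : vertexChar hI a (idem I b) = 0 := by
  classical
  rw [idem, vertexChar_path, pathAlgebraChar_eq_coeff]
  simp only [PathAlgebra.of, LinearEquiv.apply_symm_apply]
  rw [Finsupp.single_apply, if_neg]
  intro h'
  exact h (congrArg Sigma.fst h').symm

theorem vertexChar_of_length_pos (a : V) {b c : V} {q : Quiver.Path b c} (h : 0 < q.length) :
    vertexChar hI a (path I q) = 0 := by
  classical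
  rw [vertexChar_path, pathAlgebraChar_eq_coeff]
  simp only [PathAlgebra.of, LinearEquiv.apply_symm_apply]
  rw [Finsupp.single_apply, if_neg]
  intro h'
  have := congrArg (fun q : AnyPath V => q.2.2.length) h'
  simp at this
  omega

variable (I) in
/-- The span in `Λ` of the paths of length at least `n`. -/
noncomputable def longPaths (n : ℕ) : Submodule K (QuiverAlgebra I) :=
  Submodule.span K {x | ∃ (a b : V) (q : Quiver.Path a b), n ≤ q.length ∧ x = path I q}

theorem path_mem_longPaths {n : ℕ} {a b : V} {q : Quiver.Path a b} (h : n ≤ q.length) :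
    path I q ∈ longPaths I n := Submodule.subset_span ⟨a, b, q, h, rfl⟩

theorem mul_mem_longPaths {x y : QuiverAlgebra I} {i j : ℕ} (hx : x ∈ longPaths I i)
    (hy : y ∈ longPaths I j) : x * y ∈ longPaths I (i + j) := by
  refine Submodule.span_induction₂ (p := fun x y _ _ => x * y ∈ longPaths I (i + j)) ?_ ?_ ?_ ?_ ?_
    ?_ ?_ hx hy
  · rintro _ _ ⟨a, b, q, hq, rfl⟩ ⟨a', b', p, hp, rfl⟩
    by_cases h : b' = a
    · subst h
      rw [path_mul_path]
      exact path_mem_longPaths (by rw [Quiver.Path.length_comp]; omega)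
    · rw [path_mul_path_of_ne I _ _ h]
      exact zero_mem _
  · intro y _; rw [zero_mul]; exact zero_mem _
  · intro y _; rw [mul_zero]; exact zero_mem _
  · intro x y z _ _ _ h h'; rw [add_mul]; exact add_mem h h'
  · intro x y z _ _ _ h h'; rw [mul_add]; exact add_mem h h'
  · intro c x y _ _ h; rw [smul_mul_assoc]; exact Submodule.smul_mem _ _ h
  · intro c x y _ _ h; rw [mul_smul_comm]; exact Submodule.smul_mem _ _ h

/-- Modulo the paths of positive length, every element is a combination of the vertex
idempotents. -/
theorem sub_sum_mem_longPaths (x : QuiverAlgebra I) :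
    x - ∑ a : V, vertexChar hI a x • idem I a ∈ longPaths I 1 := by
  induction x using path_induction with
  | h0 => simp
  | hadd x y hx hy =>
    convert add_mem hx hy using 1
    simp only [map_add, add_smul, Finset.sum_add_distrib]
    abel
  | hsmul c x hx =>
    convert Submodule.smul_mem _ c hx using 1
    simp only [map_smul, smul_eq_mul, mul_smul, smul_sub, Finset.smul_sum]
  | @hpath a b p =>
    cases p with
    | nil =>
      change idem I a - _ ∈ _
      rw [Finset.sum_eq_single a]
      · change idem I a - vertexChar hI a (idem I a) • idem I a ∈ _
        rw [vertexChar_idem_self, one_smul, sub_self]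
        exact zero_mem _
      · intro b _ hb
        change vertexChar hI b (idem I a) • _ = _
        rw [vertexChar_idem_of_ne hI hb, zero_smul]
      · simp
    | cons p α =>
      rw [Finset.sum_eq_zero, sub_zero]
      · exact path_mem_longPaths (by simp)
      · intro b _
        rw [vertexChar_of_length_pos hI b (by simp), zero_smul]

/-- The elements killed by all vertex characters are the combinations of paths of positive
length. -/
theorem mem_longPaths_one {x : QuiverAlgebra I} :
    x ∈ longPaths I 1 ↔ ∀ a, vertexChar hI a x = 0 := by
  constructor
  · intro hx a
    induction hx using Submodule.span_induction with
    | mem x hx => obtain ⟨a, b, q, hq, rfl⟩ := hx; exact vertexChar_of_length_pos hI _ hq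
    | zero => exact map_zero _
    | add x y _ _ hx hy => rw [map_add, hx, hy, add_zero]
    | smul c x _ hx => rw [map_smul, hx, smul_zero]
  · intro h
    have := sub_sum_mem_longPaths hI x
    simpa [h] using this

/-- The Jacobson radical is spanned by the paths of positive length. -/
theorem mem_jacobson {x : QuiverAlgebra I} :
    x ∈ Ring.jacobson (QuiverAlgebra I) ↔ ∀ a, vertexChar hI a x = 0 := by
  constructor
  · intro hx a
    -- The kernel of a character is a maximal left ideal.
    have hmax : (RingHom.ker (vertexChar hI a)).IsMaximal := by
      have hone : vertexChar hI a ((1 : QuiverAlgebra I)) = 1 := map_one _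
      constructor
      constructor
      · rw [Ne, Ideal.eq_top_iff_one, RingHom.mem_ker, hone]
        exact one_ne_zero
      · intro L hL
        obtain ⟨y, hyL, hy⟩ := SetLike.exists_of_lt hL
        rw [RingHom.mem_ker] at hy
        rw [Ideal.eq_top_iff_one]
        have h1 : (1 : QuiverAlgebra I) - (vertexChar hI a y)⁻¹ • y ∈ L := by
          apply hL.le
          rw [RingHom.mem_ker, map_sub, map_smul, hone, smul_eq_mul, inv_mul_cancel₀ hy, sub_self]
        have h2 : (vertexChar hI a y)⁻¹ • y ∈ L := by
          rw [Algebra.smul_def]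
          exact L.mul_mem_left _ hyL
        have h3 := add_mem h1 h2
        rwa [sub_add_cancel] at h3
    exact Ring.jacobson_le_of_isMaximal (RingHom.ker (vertexChar hI a)) hx
  · intro hx
    rw [← Ideal.jacobson_bot, Ideal.mem_jacobson_iff]
    intro y
    have hyx : y * x ∈ longPaths I 1 := (mem_longPaths_one hI).2 fun a => by
      rw [map_mul, hx, mul_zero]
    -- All multiples `y * x` are nilpotent, so that `1 + y * x` is invertible.
    have hpow : ∀ n, (y * x) ^ (n + 1) ∈ longPaths I (n + 1) := by
      intro n
      induction n with
      | zero => simpa using hyx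
      | succ n ih => rw [pow_succ]; exact mul_mem_longPaths ih hyx
    have hnil : IsNilpotent (y * x) := by
      obtain ⟨N, hN⟩ := hI.2
      refine ⟨N + 1, ?_⟩
      have hzero : longPaths I (N + 1) = ⊥ := by
        rw [longPaths, Submodule.span_eq_bot]
        rintro _ ⟨a, b, q, hq, rfl⟩
        exact (path_eq_zero I).2 (hN _ _ _ (by omega))
      have := hpow N
      rwa [hzero, Submodule.mem_bot] at this
    obtain ⟨u, hu⟩ := hnil.isUnit_one_add
    refine ⟨(↑u⁻¹ : QuiverAlgebra I), ?_⟩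
    have h : (↑u⁻¹ : QuiverAlgebra I) * (1 + y * x) = 1 := by rw [← hu, Units.inv_mul]
    rw [Submodule.mem_bot, mul_assoc, ← h]
    noncomm_ring

theorem jacobson_eq_longPaths (hI : PathAlgebra.IsAdmissible I) {x : QuiverAlgebra I} :
    x ∈ Ring.jacobson (QuiverAlgebra I) ↔ x ∈ longPaths I 1 := by
  rw [mem_jacobson hI, mem_longPaths_one hI]

end Basics

end QuiverAlgebra

/-! ### Projective and simple modules, and their behaviour under isomorphisms -/

namespace QuiverAlgebra

section Proj

universe u v w

variable {K : Type u} [Field K] {V : Type v} [Fintype V] [Quiver.{w} V]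
variable {I : Ideal (PathAlgebra K V)} [I.IsTwoSided]

theorem mul_idem_of_mem_proj {a : V} (x : proj I a) : (x : QuiverAlgebra I) * idem I a = x := by
  obtain ⟨y, hy⟩ := Submodule.mem_span_singleton.1 x.2
  rw [← hy, smul_eq_mul, mul_assoc, idem_mul_idem]

theorem mul_idem_mem_proj (x : QuiverAlgebra I) (a : V) : x * idem I a ∈ proj I a :=
  Submodule.mem_span_singleton.2 ⟨x, rfl⟩

theorem smul_projPath_nil {a : V} (x : proj I a) :
    (x : QuiverAlgebra I) • projPath I (Quiver.Path.nil : Quiver.Path a a) = x :=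
  Subtype.ext (mul_idem_of_mem_proj x)

theorem projPath_cons {a b c : V} (q : Quiver.Path a b) (α : b ⟶ c) :
    projPath I (q.cons α) = path I α.toPath • projPath I q := Subtype.ext (path_cons I q α)

theorem idem_smul_projPath {a b : V} (q : Quiver.Path a b) :
    idem I b • projPath I q = projPath I q := Subtype.ext (idem_mul_path I q)

theorem idem_smul_projPath_of_ne {a b c : V} (q : Quiver.Path a b) (h : b ≠ c) :
    idem I c • projPath I q = 0 := Subtype.ext (idem_mul_path_of_ne I q h)

theorem finiteDimensional_proj [∀ a b : V, Finite (a ⟶ b)] (hI : PathAlgebra.IsAdmissible I)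
    (a : V) : FiniteDimensional K (proj I a) := by
  have := finiteDimensional hI
  exact inferInstanceAs (FiniteDimensional K ((proj I a).restrictScalars K))

theorem mem_radProj {a : V} {x : proj I a} :
    x ∈ radProj I a ↔ (x : QuiverAlgebra I) ∈ Ring.jacobson (QuiverAlgebra I) := by
  constructor
  · rintro ⟨y, hy, hyx⟩
    have : y * idem I a = x := hyx
    rw [← this]
    exact Ideal.mul_mem_right _ _ hy
  · intro hx
    exact ⟨x, hx, mul_idem_of_mem_proj x⟩

variable (hI : PathAlgebra.IsAdmissible I)

/-- In `Λe`, the radical has codimension one. -/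
theorem sub_smul_idem_mem_jacobson {a : V} (x : proj I a) :
    (x : QuiverAlgebra I) - vertexChar hI a x • idem I a ∈ Ring.jacobson (QuiverAlgebra I) := by
  rw [mem_jacobson hI]
  intro b
  by_cases hb : b = a
  · subst hb
    rw [map_sub, map_smul, vertexChar_idem_self, smul_eq_mul, mul_one, sub_self]
  · rw [map_sub, map_smul, vertexChar_idem_of_ne hI hb, smul_zero, sub_zero,
      ← mul_idem_of_mem_proj x, map_mul, vertexChar_idem_of_ne hI hb, mul_zero]

/-- `Λ` acts on the simple module at a vertex by the character of that vertex. -/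
theorem smul_simple {a : V} (y : QuiverAlgebra I) (z : Simple I a) :
    y • z = algebraMap K (QuiverAlgebra I) (vertexChar hI a y) • z := by
  obtain ⟨x, rfl⟩ := Submodule.Quotient.mk_surjective _ z
  rw [← Submodule.Quotient.mk_smul, ← Submodule.Quotient.mk_smul, Submodule.Quotient.eq,
    mem_radProj, mem_jacobson hI]
  intro b
  by_cases hb : b = a
  · subst hb
    simp
  · rw [← mul_idem_of_mem_proj (_ - _), map_mul, vertexChar_idem_of_ne hI hb, mul_zero]

include hI in
theorem exists_smul_eq_of_simple {a : V} {z : Simple I a} (hz : z ≠ 0) (z' : Simple I a) :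
    ∃ c : K, z' = algebraMap K (QuiverAlgebra I) c • z := by
  obtain ⟨x, rfl⟩ := Submodule.Quotient.mk_surjective _ z
  obtain ⟨x', rfl⟩ := Submodule.Quotient.mk_surjective _ z'
  have hrad : ∀ y : proj I a, vertexChar hI a y = 0 → y ∈ radProj I a := fun y hy => by
    have := sub_smul_idem_mem_jacobson hI y
    rwa [hy, zero_smul, sub_zero, ← mem_radProj] at this
  have hx : vertexChar hI a x ≠ 0 := fun h =>
    hz ((Submodule.Quotient.mk_eq_zero _).2 (hrad x h))
  refine ⟨vertexChar hI a x' * (vertexChar hI a x)⁻¹, ?_⟩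
  rw [← Submodule.Quotient.mk_smul, Submodule.Quotient.eq]
  apply hrad
  simp [hx]

include hI in
theorem exists_ne_zero_simple (a : V) : ∃ z : Simple I a, z ≠ 0 := by
  refine ⟨Submodule.Quotient.mk (projPath I Quiver.Path.nil), fun h => ?_⟩
  rw [Submodule.Quotient.mk_eq_zero, mem_radProj, mem_jacobson hI] at h
  have h1 : vertexChar hI a (idem I a) = 0 := h a
  rw [vertexChar_idem_self] at h1
  exact one_ne_zero h1

variable {V' : Type*} [Fintype V'] [Quiver V']
variable {I' : Ideal (PathAlgebra K V')} [I'.IsTwoSided] (hI' : PathAlgebra.IsAdmissible I')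
variable (f : QuiverAlgebra I ≃ₐ[K] QuiverAlgebra I')

/-- Simple modules which correspond to each other under an isomorphism belong to vertices with
corresponding characters. -/
theorem vertexChar_apply_of_simple {a : V} {a' : V'} (g : Simple I a ≃+ Simple I' a')
    (hg : ∀ y z, g (y • z) = f y • g z) (y : QuiverAlgebra I) :
    vertexChar hI' a' (f y) = vertexChar hI a y := by
  obtain ⟨z, hz⟩ := exists_ne_zero_simple hI a
  have hgz : g z ≠ 0 := fun h => hz (g.injective (h.trans (map_zero g).symm))
  have h1 : f (y - algebraMap K _ (vertexChar hI a y)) • g z = 0 := by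
    rw [← hg, sub_smul, ← smul_simple hI, sub_self, map_zero]
  by_contra hne
  have h2 : vertexChar hI' a' (f (y - algebraMap K _ (vertexChar hI a y))) ≠ 0 := by
    simpa [sub_eq_zero] using hne
  rw [smul_simple hI'] at h1
  have h3 := congrArg (fun z => algebraMap K (QuiverAlgebra I')
    (vertexChar hI' a' (f (y - algebraMap K _ (vertexChar hI a y))))⁻¹ • z) h1
  simp only [smul_smul, ← map_mul, inv_mul_cancel₀ h2, map_one, one_smul, smul_zero] at h3
  exact hgz h3

theorem apply_mem_jacobson {x : QuiverAlgebra I} :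
    f x ∈ Ring.jacobson (QuiverAlgebra I') ↔ x ∈ Ring.jacobson (QuiverAlgebra I) := by
  refine ⟨fun hx => ?_, ?_⟩
  · have : RingHomSurjective (f.symm.toRingEquiv : QuiverAlgebra I' →+* QuiverAlgebra I) :=
      ⟨f.symm.surjective⟩
    have := Ring.le_comap_jacobson (f.symm.toRingEquiv : QuiverAlgebra I' →+* QuiverAlgebra I) hx
    simpa using this
  · have : RingHomSurjective (f.toRingEquiv : QuiverAlgebra I →+* QuiverAlgebra I') :=
      ⟨f.surjective⟩
    exact fun hx =>
      Ring.le_comap_jacobson (f.toRingEquiv : QuiverAlgebra I →+* QuiverAlgebra I') hx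

/-- The map `Λ e → Λ' e'` given by `x ↦ f(x) e'`. -/
noncomputable def projMap (a : V) (a' : V') : proj I a →ₗ[K] proj I' a' where
  toFun x := ⟨f x * idem I' a', mul_idem_mem_proj _ _⟩
  map_add' x y := Subtype.ext (by simp [add_mul])
  map_smul' c x := Subtype.ext (by simp)

theorem projMap_smul (a : V) (a' : V') (y : QuiverAlgebra I) (x : proj I a) :
    projMap f a a' (y • x) = f y • projMap f a a' x := Subtype.ext (by simp [projMap, mul_assoc])

include hI hI' in
/-- The element `f(e) e'` differs from `e'` by an element of the radical, whence it generates
`Λ' e'`. -/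
theorem projMap_surjective {a : V} {a' : V'}
    (h : ∀ y, vertexChar hI' a' (f y) = vertexChar hI a y) :
    Function.Surjective (projMap f a a') := by
  have hmem := sub_smul_idem_mem_jacobson hI' (projMap f a a' (projPath I Quiver.Path.nil))
  change f (idem I a) * idem I' a' - vertexChar hI' a' (f (idem I a) * idem I' a') • _ ∈ _ at hmem
  rw [map_mul, h, vertexChar_idem_self, vertexChar_idem_self, one_mul, one_smul,
    ← Ideal.jacobson_bot, Ideal.mem_jacobson_iff] at hmem
  obtain ⟨z, hz⟩ := hmem 1
  rw [Submodule.mem_bot, mul_one] at hz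
  have hz' : z * (f (idem I a) * idem I' a') = idem I' a' := by
    have := congrArg (· * idem I' a') hz
    simp only [sub_mul, add_mul, mul_sub, mul_assoc, idem_mul_idem, one_mul, zero_mul] at this
    rw [sub_add_cancel, sub_eq_zero] at this
    exact this
  intro y
  refine ⟨f.symm (y * z) • projPath I Quiver.Path.nil, ?_⟩
  rw [projMap_smul]
  refine Subtype.ext ?_
  change f (f.symm (y * z)) * (f (idem I a) * idem I' a') = y
  rw [AlgEquiv.apply_symm_apply, mul_assoc, hz', mul_idem_of_mem_proj]

include hI hI' in
theorem projMap_bijective [∀ a b : V, Finite (a ⟶ b)] [∀ a b : V', Finite (a ⟶ b)]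
    {a : V} {a' : V'} (h : ∀ y, vertexChar hI' a' (f y) = vertexChar hI a y) :
    Function.Bijective (projMap f a a') := by
  have hs := projMap_surjective hI hI' f h
  have hs' := projMap_surjective hI' hI f.symm (a := a') (a' := a) fun y => by
    rw [← h, AlgEquiv.apply_symm_apply]
  have := finiteDimensional_proj hI a
  have := finiteDimensional_proj hI' a'
  have hrank : Module.finrank K (proj I a) = Module.finrank K (proj I' a') :=
    le_antisymm (LinearMap.finrank_le_finrank_of_surjective hs')
      (LinearMap.finrank_le_finrank_of_surjective hs)
  exact ⟨(LinearMap.injective_iff_surjective_of_finrank_eq_finrank hrank).2 hs, hs⟩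

end Proj

end QuiverAlgebra

/-! ### Flags of submodules with prescribed one-dimensional factors -/

namespace QuiverAlgebra

section Flag

universe u v w

variable {K : Type u} [Field K] {V : Type v} [Fintype V] [Quiver.{w} V]
variable {I : Ideal (PathAlgebra K V)} [I.IsTwoSided] {l : ℕ} {S : Fin (l + 1) → V}

theorem length_subpath {V : Type*} [Quiver V] {l : ℕ} {S : Fin (l + 1) → V}
    (γ : ∀ i : Fin l, S i.castSucc ⟶ S i.succ) (i : Fin (l + 1)) : (subpath γ i).length = i := by
  induction i using Fin.induction with
  | zero => rfl
  | succ i ih =>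
    change (subpath γ i.castSucc).length + 1 = _
    rw [ih]
    simp

theorem projPath_subpath_succ (γ : ∀ i : Fin l, S i.castSucc ⟶ S i.succ) (i : Fin l) :
    projPath I (subpath γ i.succ) = path I (γ i).toPath • projPath I (subpath γ i.castSucc) :=
  projPath_cons (subpath γ i.castSucc) (γ i)

/-- If the radical shifts the filtration `L`, then `p_i` lies in `L i`. -/
theorem projPath_subpath_mem (hI : PathAlgebra.IsAdmissible I)
    {L : ℕ → Submodule (QuiverAlgebra I) (proj I (S 0))} (h0 : L 0 = ⊤)
    (hrad : ∀ i ≤ l, ∀ a ∈ Ring.jacobson (QuiverAlgebra I), ∀ x ∈ L i, a • x ∈ L (i + 1))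
    (γ : ∀ i : Fin l, S i.castSucc ⟶ S i.succ) (i : Fin (l + 1)) :
    projPath I (subpath γ i) ∈ L i := by
  induction i using Fin.induction with
  | zero => simp [h0]
  | succ i ih =>
    rw [projPath_subpath_succ, Fin.val_succ]
    refine hrad _ (by omega) _ ?_ _ ih
    rw [jacobson_eq_longPaths hI]
    exact path_mem_longPaths (by simp)

/-- If the radical shifts the filtration `L`, and `p_l` does not lie in the last term, then `p_i`
does not lie in `L (i + 1)`. -/
theorem projPath_subpath_notMem (hI : PathAlgebra.IsAdmissible I)
    {L : ℕ → Submodule (QuiverAlgebra I) (proj I (S 0))}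
    (hrad : ∀ i ≤ l, ∀ a ∈ Ring.jacobson (QuiverAlgebra I), ∀ x ∈ L i, a • x ∈ L (i + 1))
    (γ : ∀ i : Fin l, S i.castSucc ⟶ S i.succ)
    (hl : projPath I (subpath γ (Fin.last l)) ∉ L (l + 1)) (i : Fin (l + 1)) :
    projPath I (subpath γ i) ∉ L (i + 1) := by
  induction i using Fin.reverseInduction with
  | last => exact hl
  | cast i ih =>
    intro h
    apply ih
    rw [projPath_subpath_succ, Fin.val_succ]
    refine hrad _ (by omega) _ ?_ _ h
    rw [jacobson_eq_longPaths hI]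
    exact path_mem_longPaths (by simp)

/-- A filtration `Λe = L 0 ⊇ ⋯ ⊇ L (l + 1) = C` by submodules, in which the factor `L i / L (i + 1)`
has dimension at most one and `Λ` acts on it as on the simple module at the vertex `S i`. -/
structure IsFlag (hI : PathAlgebra.IsAdmissible I)
    (C : Submodule (QuiverAlgebra I) (proj I (S 0)))
    (L : ℕ → Submodule (QuiverAlgebra I) (proj I (S 0))) : Prop where
  zero : L 0 = ⊤
  last : L (l + 1) = C
  anti : Antitone L
  char : ∀ (i : Fin (l + 1)) (a : QuiverAlgebra I), ∀ x ∈ L i,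
    a • x - vertexChar hI (S i) a • x ∈ L (i + 1)
  line : ∀ (i : Fin (l + 1)) (x y : proj I (S 0)), x ∈ L i → x ∉ L (i + 1) → y ∈ L i →
    ∃ c : K, y - c • x ∈ L (i + 1)

variable {hI : PathAlgebra.IsAdmissible I} {C : Submodule (QuiverAlgebra I) (proj I (S 0))}
  {L : ℕ → Submodule (QuiverAlgebra I) (proj I (S 0))}

theorem IsFlag.rad (h : IsFlag hI C L) : ∀ i ≤ l, ∀ a ∈ Ring.jacobson (QuiverAlgebra I),
    ∀ x ∈ L i, a • x ∈ L (i + 1) := by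
  intro i hi a ha x hx
  have := h.char ⟨i, by omega⟩ a x hx
  rwa [(mem_jacobson hI).1 ha, zero_smul, sub_zero] at this

/-- A combination of elements which mark the steps of a flag lies in the `n`-th term only if its
first `n` coefficients vanish. -/
theorem IsFlag.coeff_eq_zero (h : IsFlag hI C L) {q : Fin (l + 1) → proj I (S 0)}
    (hq : ∀ i : Fin (l + 1), q i ∈ L i) (hq' : ∀ i : Fin (l + 1), q i ∉ L (i + 1)) {n : ℕ}
    {c : Fin (l + 1) → K} (hc : ∑ i, c i • q i ∈ L n) :
    ∀ i : Fin (l + 1), (i : ℕ) < n → c i = 0 := by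
  intro i
  induction i using WellFoundedLT.induction with
  | ind i ih =>
  intro hi
  by_contra hne
  have hsum : ∑ j, c j • q j - c i • q i ∈ L (i + 1) := by
    rw [← Finset.sum_erase_eq_sub (Finset.mem_univ i)]
    refine Submodule.sum_mem _ fun j hj => ?_
    rcases lt_or_gt_of_ne (Finset.ne_of_mem_erase hj) with hji | hij
    · rw [ih j hji (lt_trans hji hi), zero_smul]
      exact zero_mem _
    · exact Submodule.smul_of_tower_mem _ _ (h.anti (Nat.succ_le_of_lt hij) (hq j))
  have h1 : c i • q i ∈ L (i + 1) := by
    have := sub_mem (h.anti (Nat.succ_le_of_lt hi) hc) hsum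
    rwa [sub_sub_cancel] at this
  have h2 := Submodule.smul_of_tower_mem (L (i + 1)) (c i)⁻¹ h1
  rw [smul_smul, inv_mul_cancel₀ hne, one_smul] at h2
  exact hq' i h2

theorem IsFlag.path_smul_mem (h : IsFlag hI C L) {i : ℕ} {x : proj I (S 0)} (hx : x ∈ L i) {b c : V}
    (q : Quiver.Path b c) (hq : i + q.length ≤ l + 1) : path I q • x ∈ L (i + q.length) := by
  induction q with
  | nil => exact Submodule.smul_mem _ _ hx
  | cons q α ih =>
    rw [Quiver.Path.length_cons] at hq ⊢
    rw [path_cons, mul_smul]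
    refine h.rad (i + q.length) (by omega) _ ?_ _ (ih (by omega))
    rw [jacobson_eq_longPaths hI]
    exact path_mem_longPaths (by simp)

/-- Elements which mark the steps of a flag span a complement of its last term. -/
theorem IsFlag.isCompl (h : IsFlag hI C L) {q : Fin (l + 1) → proj I (S 0)}
    (hq : ∀ i : Fin (l + 1), q i ∈ L i) (hq' : ∀ i : Fin (l + 1), q i ∉ L (i + 1)) :
    IsCompl (C.restrictScalars K) (Submodule.span K (Set.range q)) := by
  refine IsCompl.symm ⟨?_, ?_⟩
  · rw [Submodule.disjoint_def]
    intro x hx hxC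
    obtain ⟨c, rfl⟩ := (Submodule.mem_span_range_iff_exists_fun K).1 hx
    have hC : ∑ i, c i • q i ∈ L (l + 1) := by rw [h.last]; exact hxC
    exact Finset.sum_eq_zero fun i _ => by
      rw [h.coeff_eq_zero hq hq' hC i i.2, zero_smul]
  · rw [codisjoint_iff, eq_top_iff]
    rintro x -
    have key : ∀ n ≤ l + 1, ∃ a ∈ Submodule.span K (Set.range q), x - a ∈ L n := by
      intro n
      induction n with
      | zero => exact fun _ => ⟨0, zero_mem _, by simp [h.zero]⟩
      | succ n ih =>
        intro hn
        obtain ⟨a, ha, hxa⟩ := ih (by omega)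
        obtain ⟨c, hc⟩ := h.line ⟨n, by omega⟩ _ _ (hq ⟨n, by omega⟩) (hq' ⟨n, by omega⟩) hxa
        refine ⟨a + c • q ⟨n, by omega⟩,
          add_mem ha (Submodule.smul_mem _ _ (Submodule.subset_span ⟨_, rfl⟩)), ?_⟩
        rwa [← sub_sub]
    obtain ⟨a, ha, hxa⟩ := key (l + 1) le_rfl
    rw [h.last] at hxa
    exact Submodule.mem_sup.2 ⟨a, ha, x - a, hxa, by abel⟩

/-- Outside the last term of a flag there are only paths which pass through a subsequence of the
vertices `S 0, …, S l`. -/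
theorem IsFlag.isRoute (h : IsFlag hI C L) {b : V} (q : Quiver.Path (S 0) b)
    (hq : projPath I q ∉ C) : IsRoute S q := by
  have key : ∀ {b : V} (q : Quiver.Path (S 0) b), ∀ i : ℕ, i ≤ l → projPath I q ∉ L (i + 1) →
      q.vertices.Sublist ((List.ofFn S).take (i + 1)) := by
    intro b q
    induction q with
    | nil =>
      intro i _ _
      rw [Quiver.Path.vertices_nil, List.singleton_sublist, List.ofFn_succ, List.take_succ_cons]
      exact List.mem_cons_self
    | @cons b c q α ih =>
      classical
      intro i hi hqi
      -- `j` is the layer of the flag which contains the extended path; it lies strictly below the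
      -- layer of `q`, and its vertex is the end of the path.
      have hex : ∃ j, projPath I (q.cons α) ∉ L (j + 1) := ⟨i, hqi⟩
      let j := Nat.find hex
      have hj : projPath I (q.cons α) ∉ L (j + 1) := Nat.find_spec hex
      have hji : j ≤ i := Nat.find_min' hex hqi
      have hjmem : projPath I (q.cons α) ∈ L j := by
        rcases Nat.eq_zero_or_pos j with hj0 | hj0
        · rw [hj0, h.zero]
          trivial
        · have := Nat.find_min hex (m := j - 1) (by omega)
          rw [not_not, Nat.sub_add_cancel hj0] at this
          exact this
      have hα : path I α.toPath ∈ Ring.jacobson (QuiverAlgebra I) := by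
        rw [jacobson_eq_longPaths hI]
        exact path_mem_longPaths (by simp)
      have hqj : projPath I q ∉ L j := fun hmem => hj (by
        rw [projPath_cons]
        exact h.rad j (by omega) _ hα _ hmem)
      have hj0 : 0 < j := by
        by_contra h0
        apply hqj
        rw [Nat.eq_zero_of_not_pos h0, h.zero]
        trivial
      have hc : c = S ⟨j, by omega⟩ := by
        by_contra hne
        have := h.char ⟨j, by omega⟩ (idem I c) _ hjmem
        rw [vertexChar_idem_of_ne hI (Ne.symm hne), zero_smul, sub_zero, idem_smul_projPath] at this
        exact hj this
      have hsub : (q.cons α).vertices.Sublist ((List.ofFn S).take (j + 1)) := by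
        have h1 := ih (j - 1) (by omega) (by rwa [Nat.sub_add_cancel hj0])
        rw [Nat.sub_add_cancel hj0] at h1
        rw [Quiver.Path.vertices_cons, List.concat_eq_append,
          List.take_succ_eq_append_getElem (by simp; omega), List.getElem_ofFn, ← hc]
        exact h1.append (List.Sublist.refl _)
      exact hsub.trans (List.take_sublist_take_left (by omega))
  rw [← h.last] at hq
  exact (key q l le_rfl hq).trans (List.take_sublist _ _)

/-- A flag in which the radical maps no term `L i` into `L (i + 2)` is marked by the right subpaths
of a path through `S`. -/
theorem IsFlag.exists_pathThrough (h : IsFlag hI C L) (h1 : L 1 ≠ ⊤)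
    (h2 : ∀ i < l, ∃ a ∈ Ring.jacobson (QuiverAlgebra I), ∃ x ∈ L i, a • x ∉ L (i + 2)) :
    ∃ p : PathThrough I S, IsCompl (C.restrictScalars K) (pathSpan p) := by
  have hrad := h.rad
  have harrow : ∀ i : Fin l, ∃ γ : S i.castSucc ⟶ S i.succ, ∀ x ∈ L i, x ∉ L (i + 1) →
      path I γ.toPath • x ∉ L (i + 2) := by
    intro i
    obtain ⟨a, ha, x, hx, hax⟩ := h2 i i.2
    -- Since the radical is spanned by paths, some path of positive length maps `x` outside
    -- `L (i + 2)`; it has length one, and its ends are the vertices of the layers `i`, `i + 1`.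
    have hq : ∃ (b c : V) (q : Quiver.Path b c), 1 ≤ q.length ∧ path I q • x ∉ L (i + 2) := by
      by_contra hcon
      push Not at hcon
      rw [jacobson_eq_longPaths hI] at ha
      refine hax ?_
      clear hax
      induction ha using Submodule.span_induction with
      | mem a ha => obtain ⟨b, c, q, hq, rfl⟩ := ha; exact hcon b c q hq
      | zero => rw [zero_smul]; exact zero_mem _
      | add a b _ _ ha hb => rw [add_smul]; exact add_mem ha hb
      | smul c a _ ha => rw [smul_assoc]; exact Submodule.smul_of_tower_mem _ _ ha
    obtain ⟨b, c, q, hq1, hq⟩ := hq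
    have hJ : ∀ {b c : V} (q : Quiver.Path b c), 1 ≤ q.length →
        path I q ∈ Ring.jacobson (QuiverAlgebra I) := fun q hq => by
      rw [jacobson_eq_longPaths hI]
      exact path_mem_longPaths hq
    cases q with
    | nil => simp at hq1
    | @cons b' _ q α =>
    cases q with
    | cons q β =>
      refine absurd ?_ hq
      rw [path_cons, mul_smul]
      exact hrad (i + 1) (by omega) _ (hJ _ (by simp)) _
        (hrad i (by omega) _ (hJ _ (by simp)) _ hx)
    | nil =>
    change path I α.toPath • x ∉ _ at hq
    have hαJ := hJ α.toPath (by simp)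
    have hb : b = S i.castSucc := by
      by_contra hne
      have hbx := h.char i.castSucc (idem I b) x hx
      rw [vertexChar_idem_of_ne hI (Ne.symm hne), zero_smul, sub_zero] at hbx
      have := hrad (i + 1) (by omega) _ hαJ _ hbx
      rw [smul_smul, path_mul_idem] at this
      exact hq this
    have hc : c = S i.succ := by
      by_contra hne
      have hcx := h.char i.succ (idem I c) _ (hrad i (by omega) _ hαJ _ hx)
      rw [vertexChar_idem_of_ne hI (Ne.symm hne), zero_smul, sub_zero, smul_smul,
        idem_mul_path] at hcx
      exact hq hcx
    subst hb hc
    refine ⟨α, fun y hy hy' hαy => hq ?_⟩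
    obtain ⟨c, hc⟩ := h.line i.castSucc y x hy hy' hx
    have := hrad (i + 1) (by omega) _ hαJ _ hc
    rw [smul_sub, smul_comm] at this
    have := add_mem this (Submodule.smul_of_tower_mem (L (i + 2)) c hαy)
    rwa [sub_add_cancel] at this
  choose γ hγ using harrow
  have hmem := projPath_subpath_mem hI h.zero hrad γ
  have hnot : ∀ i : Fin (l + 1), projPath I (subpath γ i) ∉ L (i + 1) := by
    intro i
    induction i using Fin.induction with
    | zero =>
      intro hz
      refine h1 (eq_top_iff.2 fun x _ => ?_)
      rw [← smul_projPath_nil x]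
      exact Submodule.smul_mem _ _ hz
    | succ i ih =>
      rw [projPath_subpath_succ]
      exact hγ i _ (hmem i.castSucc) ih
  refine ⟨⟨γ, fun hp => hnot (Fin.last l) ?_⟩, h.isCompl hmem hnot⟩
  have : projPath I (subpath γ (Fin.last l)) = 0 := Subtype.ext ((path_eq_zero I).2 hp)
  rw [this]
  exact zero_mem _

/-- Nakayama's lemma relative to a submodule. -/
theorem le_of_le_jacobson_smul_sup {R M : Type*} [Ring R] [AddCommGroup M] [Module R M]
    [IsNoetherian R M] {N C : Submodule R M} (h : N ≤ Ring.jacobson R • N ⊔ C) : N ≤ C := by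
  have h1 : N.map C.mkQ ≤ Ring.jacobson R • N.map C.mkQ := by
    have := Submodule.map_mono (f := C.mkQ) h
    rwa [Submodule.map_sup, Submodule.map_smul'', Submodule.mkQ_map_self, sup_bot_eq] at this
  have h2 := Submodule.FG.eq_bot_of_le_jacobson_smul (IsNoetherian.noetherian _) h1
  exact fun x hx => (Submodule.Quotient.mk_eq_zero C).1
    ((Submodule.mem_bot R).1 (h2 ▸ Submodule.mem_map_of_mem hx))

variable (C) in
/-- The filtration of `Λe` induced by the radical filtration of `Λe / C`. -/
noncomputable def radFlag : ℕ → Submodule (QuiverAlgebra I) (proj I (S 0))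
  | 0 => ⊤
  | i + 1 => Ring.jacobson (QuiverAlgebra I) • radFlag i ⊔ C

theorem le_radFlag (i : ℕ) : C ≤ radFlag C i := by
  cases i with
  | zero => exact le_top
  | succ i => exact le_sup_right

theorem radFlag_antitone : Antitone (radFlag C) :=
  antitone_nat_of_succ_le fun _ => sup_le Submodule.smul_le_right (le_radFlag _)

theorem projPath_sub_ne_zero (p : PathThrough I S) (i : Fin (l + 1)) :
    projPath I (p.sub i) ≠ 0 := by
  intro hz
  have hzero : ∀ j : Fin (l + 1), i ≤ j → projPath I (p.sub j) = 0 := by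
    intro j
    induction j using Fin.induction with
    | zero =>
      intro hij
      obtain rfl := Fin.le_zero_iff.1 hij
      exact hz
    | succ j ih =>
      intro hij
      rcases eq_or_lt_of_le hij with rfl | hlt
      · exact hz
      · have := ih (Fin.le_castSucc_iff.2 hlt)
        change projPath I (subpath p.1 j.castSucc) = 0 at this
        change projPath I (subpath p.1 j.succ) = 0
        rw [projPath_subpath_succ, this, smul_zero]
  exact p.2 ((path_eq_zero I).1 (congrArg Subtype.val (hzero _ (Fin.le_last i))))

theorem projPath_sub_notMem_of_isCompl {p : PathThrough I S}
    (h : IsCompl (C.restrictScalars K) (pathSpan p)) (i : Fin (l + 1)) :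
    projPath I (p.sub i) ∉ C := fun hi => projPath_sub_ne_zero p i
  (Submodule.disjoint_def.1 h.disjoint _ hi (Submodule.subset_span ⟨i, rfl⟩))

theorem smul_mem_radFlag {i : ℕ} {a : QuiverAlgebra I} (ha : a ∈ Ring.jacobson (QuiverAlgebra I))
    {x : proj I (S 0)} (hx : x ∈ radFlag C i) : a • x ∈ radFlag C (i + 1) :=
  Submodule.mem_sup_left (Submodule.smul_mem_smul ha hx)

/-- By Nakayama's lemma, the radical filtration of `Λe / C` decreases strictly as long as it
contains the right subpaths of a path outside `C`. -/
theorem finrank_radFlag_lt (hI : PathAlgebra.IsAdmissible I) [FiniteDimensional K (proj I (S 0))]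
    {p : PathThrough I S} (h : ∀ i, projPath I (p.sub i) ∉ C) {i : ℕ} (hi : i ≤ l) :
    Module.finrank K ((radFlag C (i + 1)).restrictScalars K) <
      Module.finrank K ((radFlag C i).restrictScalars K) := by
  have hnoeth : IsNoetherian (QuiverAlgebra I) (proj I (S 0)) :=
    isNoetherian_of_tower K inferInstance
  have hmem := projPath_subpath_mem hI (L := radFlag C) rfl
    (fun _ _ _ ha _ hx => smul_mem_radFlag ha hx) p.1
  apply Submodule.finrank_lt_finrank_of_lt
  refine lt_of_le_not_ge (radFlag_antitone i.le_succ) fun hle => ?_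
  have hle' : radFlag C i ≤ radFlag C (i + 1) := hle
  exact h ⟨i, by omega⟩ (le_of_le_jacobson_smul_sup hle' (hmem ⟨i, by omega⟩))

/-- If there is a path through `S`, the subtraction in the definition of `kernelDim` does not
truncate. -/
theorem le_finrank_proj (hI : PathAlgebra.IsAdmissible I) [FiniteDimensional K (proj I (S 0))]
    (p : PathThrough I S) : l + 1 ≤ Module.finrank K (proj I (S 0)) := by
  have h : ∀ j ≤ l + 1, j + Module.finrank K
      ((radFlag (⊥ : Submodule (QuiverAlgebra I) (proj I (S 0))) j).restrictScalars K) ≤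
        Module.finrank K (proj I (S 0)) := by
    intro j
    induction j with
    | zero => exact fun _ => by rw [zero_add]; exact Submodule.finrank_le _
    | succ j ih =>
      intro hj
      have h1 := ih (by omega)
      have h2 := finrank_radFlag_lt (C := ⊥) hI (p := p)
        (fun i => by rw [Submodule.mem_bot]; exact projPath_sub_ne_zero p i) (i := j) (by omega)
      omega
  exact (Nat.le_add_right _ _).trans (h (l + 1) le_rfl)

/-- If `C` complements the span of the right subpaths of a path `p` through `S`, then the radical
filtration of `Λe / C` is a flag: its terms strictly decrease, whence comparing dimensions shows
that each factor is the line spanned by `p_i`. -/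
theorem isFlag_radFlag (hI : PathAlgebra.IsAdmissible I) [FiniteDimensional K (proj I (S 0))]
    {p : PathThrough I S} (h : IsCompl (C.restrictScalars K) (pathSpan p)) :
    IsFlag hI C (radFlag C) := by
  have hrad : ∀ i ≤ l, ∀ a ∈ Ring.jacobson (QuiverAlgebra I), ∀ x ∈ radFlag C i,
      a • x ∈ radFlag C (i + 1) := fun _ _ _ ha _ hx => smul_mem_radFlag ha hx
  have hmem := projPath_subpath_mem hI (L := radFlag C) rfl hrad p.1
  let d : ℕ → ℕ := fun i => Module.finrank K ((radFlag C i).restrictScalars K)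
  have hstep : ∀ i ≤ l, d (i + 1) < d i := fun i hi =>
    finrank_radFlag_lt hI (projPath_sub_notMem_of_isCompl h) hi
  have hd0 : d 0 = Module.finrank K (proj I (S 0)) := by
    change Module.finrank K ((⊤ : Submodule (QuiverAlgebra I) (proj I (S 0))).restrictScalars K) = _
    rw [Submodule.restrictScalars_top, finrank_top]
  have hupper : ∀ i ≤ l + 1, d i + i ≤ d 0 := by
    intro i
    induction i with
    | zero => simp
    | succ i ih => intro hi; have := ih (by omega); have := hstep i (by omega); omega
  -- The `l + 1` strict steps of the filtration exhaust the codimension of `C`, whence each of them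
  -- has height one.
  have hlower : ∀ j ≤ l + 1, d (l + 1) + j ≤ d (l + 1 - j) := by
    intro j
    induction j with
    | zero => simp
    | succ j ih =>
      intro hj
      have h1 := ih (by omega)
      have h2 := hstep (l + 1 - (j + 1)) (by omega)
      rw [show l + 1 - (j + 1) + 1 = l + 1 - j by omega] at h2
      omega
  have hC : Module.finrank K (C.restrictScalars K) + Module.finrank K (pathSpan p) = d 0 := by
    rw [hd0]
    exact Submodule.finrank_add_eq_of_isCompl h
  have hA : Module.finrank K (pathSpan p) ≤ l + 1 := by
    have := finrank_range_le_card (R := K) fun i => projPath I (p.sub i)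
    rwa [Fintype.card_fin] at this
  have hCd : Module.finrank K (C.restrictScalars K) ≤ d (l + 1) :=
    Submodule.finrank_mono (le_radFlag (l + 1))
  have heq : ∀ i ≤ l + 1, d i + i = d 0 := by
    intro i hi
    have h1 := hupper i hi
    have h2 := hlower (l + 1 - i) (by omega)
    rw [show l + 1 - (l + 1 - i) = i by omega] at h2
    omega
  have hlast : radFlag C (l + 1) = C := by
    have h1 := heq (l + 1) le_rfl
    have h2 : C.restrictScalars K = (radFlag C (l + 1)).restrictScalars K :=
      Submodule.eq_of_le_of_finrank_le (le_radFlag (l + 1)) (by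
        change d (l + 1) ≤ _
        omega)
    exact (Submodule.restrictScalars_injective K _ _ h2).symm
  have hnot := projPath_subpath_notMem hI hrad p.1 (by
    rw [hlast]
    exact projPath_sub_notMem_of_isCompl h (Fin.last l))
  have hline : ∀ (i : Fin (l + 1)) (x y : proj I (S 0)), x ∈ radFlag C i → x ∉ radFlag C (i + 1) →
      y ∈ radFlag C i → ∃ c : K, y - c • x ∈ radFlag C (i + 1) := by
    intro i x y hx hx' hy
    have hle : (radFlag C (i + 1)).restrictScalars K ⊔ Submodule.span K {x} ≤
        (radFlag C i).restrictScalars K :=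
      sup_le (radFlag_antitone (Nat.le_succ _)) (by
        rw [Submodule.span_singleton_le_iff_mem]
        exact hx)
    have hlt : (radFlag C (i + 1)).restrictScalars K <
        (radFlag C (i + 1)).restrictScalars K ⊔ Submodule.span K {x} :=
      lt_of_le_of_ne le_sup_left fun he => hx' (by
        have : x ∈ (radFlag C (i + 1)).restrictScalars K := by
          rw [he]
          exact Submodule.mem_sup_right (Submodule.mem_span_singleton_self x)
        exact this)
    have hlt' := Submodule.finrank_lt_finrank_of_lt hlt
    have h1 := heq i (by omega)
    have h2 := heq (i + 1) (by omega)
    have htop := Submodule.eq_of_le_of_finrank_le hle (by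
      change d i ≤ _
      change d (i + 1) < _ at hlt'
      omega)
    have hy' : y ∈ (radFlag C (i + 1)).restrictScalars K ⊔ Submodule.span K {x} := by
      rw [htop]
      exact hy
    obtain ⟨z, hz, w, hw, rfl⟩ := Submodule.mem_sup.1 hy'
    obtain ⟨c, rfl⟩ := Submodule.mem_span_singleton.1 hw
    exact ⟨c, by rwa [add_sub_cancel_right]⟩
  refine ⟨rfl, hlast, radFlag_antitone, fun i a x hx => ?_, hline⟩
  obtain ⟨c, hc⟩ := hline i _ x (hmem i) (hnot i) hx
  set y := projPath I (subpath p.1 i) with hy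
  have hsub : a • y - vertexChar hI (S i) a • y ∈ radFlag C (i + 1) := by
    have hJ := sub_smul_idem_mem_jacobson hI
      (⟨a * idem I (S i), mul_idem_mem_proj a (S i)⟩ : proj I (S i))
    have h1 := hrad i (by omega) _ hJ y (hmem i)
    rw [sub_smul, mul_smul, smul_assoc, map_mul, vertexChar_idem_self, mul_one, hy,
      idem_smul_projPath, ← hy] at h1
    exact h1
  have hx' : a • x - vertexChar hI (S i) a • x =
      a • (x - c • y) - vertexChar hI (S i) a • (x - c • y) +
        c • (a • y - vertexChar hI (S i) a • y) := by
    rw [smul_sub, smul_sub, smul_sub, smul_comm a c, smul_comm (vertexChar hI (S i) a) c]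
    abel
  rw [hx']
  exact add_mem (sub_mem (Submodule.smul_mem _ _ hc) (Submodule.smul_of_tower_mem _ _ hc))
    (Submodule.smul_of_tower_mem _ _ hsub)

end Flag

end QuiverAlgebra

/-! ### Uniserial modules and flags -/

namespace QuiverAlgebra

section Uniserial

universe u v w

variable {K : Type u} [Field K] {V : Type v} [Fintype V] [Quiver.{w} V]
variable {I : Ideal (PathAlgebra K V)} [I.IsTwoSided] {l : ℕ} {S : Fin (l + 1) → V}

theorem mem_succ_of_mk_eq_zero {U : Type*} [AddCommGroup U] [Module (QuiverAlgebra I) U]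
    {A B : Submodule (QuiverAlgebra I) U} {a : V}
    (g : (A ⧸ B.submoduleOf A) ≃ₗ[QuiverAlgebra I] Simple I a) {x : A}
    (h : g (Submodule.Quotient.mk x) = 0) : (x : U) ∈ B := by
  rw [map_eq_zero_iff g g.injective, Submodule.Quotient.mk_eq_zero] at h
  exact h

/-- The kernel of the map `Λe → U` given by a top element of a uniserial module `U` is the last term
of a flag, namely of the preimage of the composition series of `U`. -/
theorem exists_isFlag_of_isUniserial (hI : PathAlgebra.IsAdmissible I) {U : Type*} [AddCommGroup U]
    [Module (QuiverAlgebra I) U] (hU : IsUniserial I S U)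
    (φ : proj I (S 0) →ₗ[QuiverAlgebra I] U) : ∃ L, IsFlag hI (LinearMap.ker φ) L := by
  obtain ⟨-, F, h0, hlast, hF⟩ := hU
  let G : ℕ → Submodule (QuiverAlgebra I) U := fun i => if h : i < l + 2 then F ⟨i, h⟩ else ⊥
  have hG : ∀ i : Fin (l + 1), G i = F i.castSucc := fun i => dif_pos (by omega)
  have hG' : ∀ i : Fin (l + 1), G (i + 1) = F i.succ := fun i => dif_pos (by omega)
  have hGlast : G (l + 1) = ⊥ := (hG' (Fin.last l)).trans hlast
  have hanti : Antitone G := antitone_nat_of_succ_le fun i => by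
    by_cases hi : i < l + 1
    · rw [hG ⟨i, hi⟩, hG' ⟨i, hi⟩]
      exact (hF ⟨i, hi⟩).1
    · have : G (i + 1) = ⊥ := dif_neg (by omega)
      rw [this]
      exact bot_le
  refine ⟨fun i => (G i).comap φ, ?_, ?_, ?_, ?_, ?_⟩
  · have : G 0 = ⊤ := h0
    simp only [this, Submodule.comap_top]
  · simp only [hGlast]
    rfl
  · exact fun i j hij => Submodule.comap_mono (hanti hij)
  · intro i a x hx
    obtain ⟨g⟩ := (hF i).2
    simp only [Submodule.mem_comap, hG, hG'] at hx ⊢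
    have h : g (Submodule.Quotient.mk ((a - algebraMap K _ (vertexChar hI (S i) a)) • ⟨φ x, hx⟩)) =
        0 := by
      rw [Submodule.Quotient.mk_smul, map_smul, sub_smul, ← smul_simple hI, sub_self]
    have h2 := mem_succ_of_mk_eq_zero g h
    rwa [← algebraMap_smul (QuiverAlgebra I) (vertexChar hI (S i) a) x, ← sub_smul, map_smul]
  · intro i x y hx hx' hy
    obtain ⟨g⟩ := (hF i).2
    simp only [Submodule.mem_comap, hG, hG'] at hx hx' hy ⊢
    have hne : g (Submodule.Quotient.mk ⟨φ x, hx⟩) ≠ 0 := fun h =>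
      hx' (mem_succ_of_mk_eq_zero g h)
    obtain ⟨c, hc⟩ := exists_smul_eq_of_simple hI hne (g (Submodule.Quotient.mk ⟨φ y, hy⟩))
    refine ⟨c, ?_⟩
    have h : g (Submodule.Quotient.mk (⟨φ y, hy⟩ - algebraMap K (QuiverAlgebra I) c • ⟨φ x, hx⟩)) =
        0 := by
      rw [Submodule.Quotient.mk_sub, Submodule.Quotient.mk_smul, map_sub, map_smul, hc, sub_self]
    have h2 := mem_succ_of_mk_eq_zero g h
    rwa [← algebraMap_smul (QuiverAlgebra I) c x, map_sub, map_smul]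

/-- A point of `V_p` comes from a submodule `C` of `Λe`, the kernel of a map onto a uniserial
module. -/
theorem exists_isFlag_of_mem_uniserialSet (hI : PathAlgebra.IsAdmissible I) {p : PathThrough I S}
    {k : p.Coord → K} (hk : k ∈ uniserialSet p) :
    ∃ C L, IsFlag hI C L ∧ IsCompl (C.restrictScalars K) (pathSpan p) ∧
      ∀ d : Detour p, projPath I d.path - d.combination k ∈ C := by
  obtain ⟨U, _, _, x, hU, ⟨y, hy⟩, hex, hx, hd⟩ := hk
  let φ : proj I (S 0) →ₗ[QuiverAlgebra I] U :=
    (LinearMap.toSpanSingleton (QuiverAlgebra I) U x).comp (proj I (S 0)).subtype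
  have hφ : ∀ z : proj I (S 0), φ z = (z : QuiverAlgebra I) • x := fun _ => rfl
  obtain ⟨L, hL⟩ := exists_isFlag_of_isUniserial hI hU φ
  have hl : projPath I (subpath p.1 (Fin.last l)) ∉ L (l + 1) := by
    rw [hL.last]
    intro hmem
    -- `p` maps the radical of `U` to zero, as it has length `l`; so `p x = 0` would imply
    -- `p U = 0`.
    have hmem' : path I (p.sub (Fin.last l)) • x = 0 := hmem
    have hyx : y ∈ Submodule.span (QuiverAlgebra I) {x} := by rw [hx]; trivial
    obtain ⟨a, rfl⟩ := Submodule.mem_span_singleton.1 hyx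
    let z : proj I (S 0) := ⟨a * idem I (S 0), mul_idem_mem_proj a (S 0)⟩
    have hJ := hL.rad 0 (Nat.zero_le l) _ (sub_smul_idem_mem_jacobson hI z)
      (projPath I Quiver.Path.nil) (by rw [hL.zero]; trivial)
    have hpJ := hL.path_smul_mem hJ (p.sub (Fin.last l)) (by
      rw [PathThrough.sub, length_subpath, Fin.val_last]; omega)
    rw [PathThrough.sub, length_subpath, Fin.val_last, show 0 + 1 + l = l + 1 by omega,
      hL.last, LinearMap.mem_ker, map_smul, map_smul, hφ] at hpJ
    have hn : ((projPath I (Quiver.Path.nil : Quiver.Path (S 0) (S 0)) : proj I (S 0)) :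
        QuiverAlgebra I) • x = x := hex
    have hz : (z : QuiverAlgebra I) • x = a • x := by
      change (a * idem I (S 0)) • x = _
      rw [mul_smul, hex]
    change path I (p.sub (Fin.last l)) • _ = 0 at hpJ
    rw [hn, Algebra.smul_def, sub_smul, hz, mul_smul, hex, smul_sub,
      ← mul_smul (path I (p.sub (Fin.last l))) (algebraMap K (QuiverAlgebra I) _),
      ← Algebra.commutes, mul_smul (algebraMap K (QuiverAlgebra I) _)] at hpJ
    rw [hmem', smul_zero, sub_zero] at hpJ
    exact hy hpJ
  refine ⟨_, L, hL, hL.isCompl (projPath_subpath_mem hI hL.zero hL.rad p.1)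
    (projPath_subpath_notMem hI hL.rad p.1 hl), fun d => ?_⟩
  rw [LinearMap.mem_ker, map_sub, hφ, hφ, ← hd d, sub_eq_zero]
  rfl

variable {C : Submodule (QuiverAlgebra I) (proj I (S 0))}

/-- The submodules of `Λe` above `C` are the terms of the radical filtration. -/
theorem exists_eq_radFlag (hI : PathAlgebra.IsAdmissible I) [FiniteDimensional K (proj I (S 0))]
    {p : PathThrough I S} (h : IsCompl (C.restrictScalars K) (pathSpan p))
    {N : Submodule (QuiverAlgebra I) (proj I (S 0))} (hN : C ≤ N) : ∃ i, N = radFlag C i := by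
  classical
  have hnoeth : IsNoetherian (QuiverAlgebra I) (proj I (S 0)) :=
    isNoetherian_of_tower K inferInstance
  have hL := isFlag_radFlag hI h
  by_cases hNC : N ≤ C
  · exact ⟨l + 1, (le_antisymm hNC hN).trans hL.last.symm⟩
  have hex : ∃ j, ¬ N ≤ radFlag C (j + 1) := ⟨l, by rwa [hL.last]⟩
  have hj := Nat.find_spec hex
  have hjl : Nat.find hex ≤ l := Nat.find_min' hex (by rwa [hL.last])
  have hjle : N ≤ radFlag C (Nat.find hex) := by
    rcases Nat.eq_zero_or_pos (Nat.find hex) with hj0 | hj0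
    · rw [hj0]
      exact le_top
    · have := Nat.find_min hex (m := Nat.find hex - 1) (by omega)
      rwa [not_not, Nat.sub_add_cancel hj0] at this
  refine ⟨Nat.find hex, le_antisymm hjle (le_of_le_jacobson_smul_sup fun y hy => ?_)⟩
  obtain ⟨x, hxN, hx⟩ := SetLike.not_le_iff_exists.1 hj
  obtain ⟨c, hc⟩ := hL.line ⟨_, Nat.lt_succ_of_le hjl⟩ x y (hjle hxN) hx hy
  have hc' : y - c • x ∈ Ring.jacobson (QuiverAlgebra I) • radFlag C (Nat.find hex) ⊔ N :=
    sup_le_sup_left hN _ hc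
  have := add_mem hc' (Submodule.mem_sup_right (Submodule.smul_of_tower_mem N c hxN))
  rwa [sub_add_cancel] at this

/-- If `C` complements the span of the right subpaths of a path through `S`, then `Λe / C` is
uniserial with composition series `S`. -/
theorem isUniserial_quotient (hI : PathAlgebra.IsAdmissible I)
    [FiniteDimensional K (proj I (S 0))] {p : PathThrough I S}
    (h : IsCompl (C.restrictScalars K) (pathSpan p)) : IsUniserial I S (proj I (S 0) ⧸ C) := by
  have hL := isFlag_radFlag hI h
  have hp := projPath_subpath_mem hI hL.zero hL.rad p.1
  have hp' := projPath_subpath_notMem hI hL.rad p.1 (by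
    rw [hL.last]
    exact projPath_sub_notMem_of_isCompl h (Fin.last l))
  have hmk : ∀ i x, Submodule.Quotient.mk x ∈ (radFlag C i).map C.mkQ ↔ x ∈ radFlag C i := by
    intro i x
    constructor
    · rintro ⟨y, hy, hxy⟩
      have := le_radFlag i ((Submodule.Quotient.eq C).1 hxy)
      simpa using sub_mem hy this
    · exact fun hx => Submodule.mem_map_of_mem hx
  refine ⟨fun A B => ?_, fun i => (radFlag C i).map C.mkQ, ?_, ?_, fun i => ⟨?_, ?_⟩⟩
  · have hcomap : ∀ A : Submodule (QuiverAlgebra I) (proj I (S 0) ⧸ C), C ≤ A.comap C.mkQ :=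
      fun A x hx => by
        rw [Submodule.mem_comap, Submodule.mkQ_apply, (Submodule.Quotient.mk_eq_zero C).2 hx]
        exact zero_mem _
    obtain ⟨i, hi⟩ := exists_eq_radFlag hI h (hcomap A)
    obtain ⟨j, hj⟩ := exists_eq_radFlag hI h (hcomap B)
    have key : ∀ A B : Submodule (QuiverAlgebra I) (proj I (S 0) ⧸ C),
        A.comap C.mkQ ≤ B.comap C.mkQ → A ≤ B := fun A B hle =>
      (Submodule.comap_le_comap_iff_of_surjective C.mkQ_surjective).1 hle
    rcases le_total i j with hij | hij
    · exact Or.inr (key _ _ (by rw [hi, hj]; exact radFlag_antitone hij))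
    · exact Or.inl (key _ _ (by rw [hi, hj]; exact radFlag_antitone hij))
  · change (⊤ : Submodule (QuiverAlgebra I) (proj I (S 0))).map C.mkQ = ⊤
    rw [Submodule.map_top, Submodule.range_mkQ]
  · change (radFlag C (l + 1)).map C.mkQ = ⊥
    rw [hL.last, Submodule.mkQ_map_self]
  · exact Submodule.map_mono (radFlag_antitone (by simp))
  · let A := (radFlag C i).map C.mkQ
    let B := (radFlag C (i + 1)).map C.mkQ
    let u : A := ⟨Submodule.Quotient.mk (projPath I (subpath p.1 i)), (hmk _ _).2 (hp i)⟩
    let φ : proj I (S i) →ₗ[QuiverAlgebra I] A ⧸ B.submoduleOf A :=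
      (B.submoduleOf A).mkQ.comp
        ((LinearMap.toSpanSingleton (QuiverAlgebra I) A u).comp (proj I (S i)).subtype)
    have hφ : ∀ y : proj I (S i), φ y = Submodule.Quotient.mk ((y : QuiverAlgebra I) • u) :=
      fun _ => rfl
    have hsurj : Function.Surjective φ := by
      intro z
      obtain ⟨⟨z, hz⟩, rfl⟩ := Submodule.Quotient.mk_surjective _ z
      obtain ⟨w, hw, rfl⟩ := hz
      obtain ⟨c, hc⟩ := hL.line i _ w (hp i) (hp' i) hw
      refine ⟨c • projPath I Quiver.Path.nil, ?_⟩
      rw [hφ, eq_comm, Submodule.Quotient.eq]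
      have hc' := (hmk _ _).2 hc
      rw [Submodule.Quotient.mk_sub, Submodule.Quotient.mk_smul,
        ← idem_smul_projPath (subpath p.1 i), Submodule.Quotient.mk_smul, ← smul_assoc] at hc'
      exact hc'
    have hker : LinearMap.ker φ = radProj I (S i) := by
      ext y
      rw [LinearMap.mem_ker, hφ, Submodule.Quotient.mk_eq_zero, mem_radProj]
      change (y : QuiverAlgebra I) • Submodule.Quotient.mk _ ∈ B ↔ _
      rw [← Submodule.Quotient.mk_smul]
      refine (hmk _ _).trans ?_
      have hchar := hL.char i y _ (hp i)
      constructor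
      · intro hy
        have h1 := sub_mem hy hchar
        rw [sub_sub_cancel] at h1
        have h0 : vertexChar hI (S i) y = 0 := by
          by_contra hne
          have h2 := Submodule.smul_of_tower_mem (radFlag C (i + 1))
            (vertexChar hI (S i) (y : QuiverAlgebra I))⁻¹ h1
          rw [smul_smul, inv_mul_cancel₀ hne, one_smul] at h2
          exact hp' i h2
        have h3 := sub_smul_idem_mem_jacobson hI y
        rwa [h0, zero_smul, sub_zero] at h3
      · intro hy
        rwa [(mem_jacobson hI).1 hy, zero_smul, sub_zero] at hchar
    exact ⟨((Submodule.quotEquivOfEq _ _ hker).symm.trans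
      (φ.quotKerEquivOfSurjective hsurj)).symm⟩

/-- If `C` complements the span of the right subpaths of `p`, then the coefficients of the detours
modulo `C` form a point of `V_p`. -/
theorem mem_uniserialSet_of_isCompl (hI : PathAlgebra.IsAdmissible I)
    [FiniteDimensional K (proj I (S 0))] {p : PathThrough I S}
    (h : IsCompl (C.restrictScalars K) (pathSpan p)) {k : p.Coord → K}
    (hk : ∀ d : Detour p, projPath I d.path - d.combination k ∈ C) : k ∈ uniserialSet p := by
  have hsmul : ∀ z : proj I (S 0), (z : QuiverAlgebra I) •
      (Submodule.Quotient.mk (projPath I Quiver.Path.nil) : proj I (S 0) ⧸ C) =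
        Submodule.Quotient.mk z := fun z => by
    rw [← Submodule.Quotient.mk_smul, smul_projPath_nil]
  refine ⟨proj I (S 0) ⧸ C, inferInstance, inferInstance,
    Submodule.Quotient.mk (projPath I Quiver.Path.nil), isUniserial_quotient hI h,
    ⟨Submodule.Quotient.mk (projPath I Quiver.Path.nil), ?_⟩, ?_, ?_, fun d => ?_⟩
  · intro h0
    have := hsmul (projPath I (p.sub (Fin.last l)))
    rw [show ((projPath I (p.sub (Fin.last l)) : proj I (S 0)) : QuiverAlgebra I) =
      path I (p.sub (Fin.last l)) from rfl, h0] at this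
    exact projPath_sub_notMem_of_isCompl h _ ((Submodule.Quotient.mk_eq_zero C).1 this.symm)
  · rw [← Submodule.Quotient.mk_smul, idem_smul_projPath]
  · rw [eq_top_iff]
    rintro z -
    obtain ⟨z, rfl⟩ := Submodule.Quotient.mk_surjective _ z
    exact Submodule.mem_span_singleton.2 ⟨z, hsmul z⟩
  · rw [hsmul (d.combination k)]
    have := hsmul (projPath I d.path)
    rw [show ((projPath I d.path : proj I (S 0)) : QuiverAlgebra I) = path I d.path from rfl]
      at this
    rw [this, Submodule.Quotient.eq]
    exact hk d

end Uniserial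

end QuiverAlgebra

/-! ### The isomorphism between `V_p` and an open subset of the variety of uniserial modules -/

namespace QuiverAlgebra

section Psi

universe u v w

open SpaceWithFunctions

variable {K : Type u} [Field K] {V : Type v} [Fintype V] [Quiver.{w} V]
variable {I : Ideal (PathAlgebra K V)} [I.IsTwoSided] {l : ℕ} {S : Fin (l + 1) → V}
variable {C : Submodule (QuiverAlgebra I) (proj I (S 0))}

open Classical in
/-- The coefficient of `p_i` in `∑ k_i(α, p_m) p_i`, for an arbitrary index `i`. -/
noncomputable def Detour.coeff {p : PathThrough I S} (d : Detour p) (i : Fin (l + 1))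
    (k : p.Coord → K) : K :=
  if h : d.m < i ∧ S i = d.tgt then k ⟨d, ⟨i, h⟩⟩ else 0

omit [I.IsTwoSided] in
theorem Detour.coeff_index {p : PathThrough I S} (d : Detour p) (i : d.Index) (k : p.Coord → K) :
    d.coeff i.1 k = k ⟨d, i⟩ := dif_pos i.2

theorem Detour.combination_eq_sum {p : PathThrough I S} (d : Detour p) (k : p.Coord → K) :
    (d.combination k : proj I (S 0)) = ∑ i, d.coeff i k • projPath I (p.sub i) := by
  classical
  have h1 : ∑ i, d.coeff i k • projPath I (p.sub i) =
      ∑ i ∈ Finset.univ.filter (fun i => d.m < i ∧ S i = d.tgt),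
        d.coeff i k • projPath I (p.sub i) := by
    refine (Finset.sum_filter_of_ne fun i _ hne => ?_).symm
    by_contra hcon
    exact hne (by rw [Detour.coeff, dif_neg hcon, zero_smul])
  rw [h1, Detour.combination, Finset.sum_subtype (p := fun i => d.m < i ∧ S i = d.tgt) _ (by simp)]
  exact Finset.sum_congr rfl fun i _ => by rw [d.coeff_index i]

omit [I.IsTwoSided] in
theorem Detour.coeff_mem_polyFun {p : PathThrough I S} (d : Detour p) (i : Fin (l + 1)) :
    d.coeff i ∈ polyFun K p.Coord := by
  by_cases h : d.m < i ∧ S i = d.tgt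
  · convert coord_mem_polyFun (K := K) (⟨d, ⟨i, h⟩⟩ : p.Coord) using 1
    ext k
    exact dif_pos h
  · convert const_mem_polyFun (K := K) (κ := p.Coord) 0 using 1
    ext k
    exact dif_neg h

/-- If `l ++ [a]` is a sublist of `L`, then `a` occurs in `L` at an index not less than the length
of `l`. -/
theorem exists_getElem_of_append_sublist {α : Type*} {l L : List α} {a : α}
    (h : (l ++ [a]).Sublist L) : ∃ (i : ℕ) (hi : i < L.length), l.length ≤ i ∧ L[i] = a := by
  obtain ⟨r₁, r₂, rfl, h₁, h₂⟩ := List.append_sublist_iff.1 h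
  obtain ⟨j, hj, hja⟩ := List.mem_iff_getElem.1 (List.singleton_sublist.1 h₂)
  refine ⟨r₁.length + j, by simpa using hj, ?_, ?_⟩
  · have := h₁.length_le
    omega
  · rw [List.getElem_append_right (by omega)]
    simpa using hja

/-- An extension of `p_m` by an arrow is congruent modulo `ψ_p(k)` to a combination of the right
subpaths of `p`, with coefficients which are polynomials in `k`. -/
theorem exists_polyFun_cons (p : PathThrough I S) (m : Fin (l + 1)) {b : V} (α : S m ⟶ b) :
    ∃ c : Fin (l + 1) → (p.Coord → K) → K, (∀ i, c i ∈ polyFun K p.Coord) ∧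
      ∀ k, projPath I ((p.sub m).cons α) - ∑ i, c i k • projPath I (p.sub i) ∈ psi p k := by
  classical
  by_cases h0 : PathAlgebra.of K ((p.sub m).cons α) ∈ I
  · refine ⟨fun _ _ => 0, fun _ => const_mem_polyFun 0, fun k => ?_⟩
    rw [show projPath I ((p.sub m).cons α) = 0 from Subtype.ext ((path_eq_zero I).2 h0)]
    simp
  by_cases hne : ∀ i : Fin l, i.castSucc = m → ((p.sub m).cons α).toAny ≠ (p.sub i.succ).toAny
  · by_cases hex : ∃ s : Fin (l + 1), m < s ∧ S s = b
    · let d : Detour p := ⟨m, b, α, h0, hne, hex⟩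
      refine ⟨d.coeff, d.coeff_mem_polyFun, fun k => ?_⟩
      rw [← d.combination_eq_sum]
      exact Submodule.subset_span (Or.inl ⟨d, rfl⟩)
    · -- Otherwise the path is not a route on the paths through `S`, and lies in `ψ_p(k)`.
      refine ⟨fun _ _ => 0, fun _ => const_mem_polyFun 0, fun k => ?_⟩
      simp only [zero_smul, Finset.sum_const_zero, sub_zero]
      refine Submodule.subset_span (Or.inr ⟨b, _, fun hroute => hex ?_, rfl⟩)
      rw [IsRoute, Quiver.Path.vertices_cons, List.concat_eq_append] at hroute
      obtain ⟨i, hi, hmi, hib⟩ := exists_getElem_of_append_sublist hroute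
      rw [List.length_ofFn] at hi
      rw [List.getElem_ofFn] at hib
      refine ⟨⟨i, hi⟩, ?_, hib⟩
      rw [Quiver.Path.vertices_length, PathThrough.sub, length_subpath] at hmi
      rw [Fin.lt_def]
      exact hmi
  · push Not at hne
    obtain ⟨i, -, hi⟩ := hne
    have hpath : projPath I ((p.sub m).cons α) = projPath I (p.sub i.succ) := by
      refine Subtype.ext ?_
      change path I ((p.sub m).cons α) = path I (p.sub i.succ)
      exact congrArg (fun q : AnyPath V => path I q.2.2) hi
    refine ⟨fun j _ => if j = i.succ then 1 else 0, fun _ => const_mem_polyFun _, fun k => ?_⟩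
    rw [hpath]
    simp

/-- Every element of `Λe` is congruent modulo `ψ_p(k)` to a combination of the right subpaths of
`p`, with coefficients which are polynomials in `k`. -/
theorem exists_polyFun (p : PathThrough I S) (x : proj I (S 0)) :
    ∃ c : Fin (l + 1) → (p.Coord → K) → K, (∀ i, c i ∈ polyFun K p.Coord) ∧
      ∀ k, x - ∑ i, c i k • projPath I (p.sub i) ∈ psi p k := by
  classical
  have hpath : ∀ {b : V} (q : Quiver.Path (S 0) b),
      ∃ c : Fin (l + 1) → (p.Coord → K) → K, (∀ i, c i ∈ polyFun K p.Coord) ∧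
        ∀ k, projPath I q - ∑ i, c i k • projPath I (p.sub i) ∈ psi p k := by
    intro b q
    induction q with
    | nil =>
      refine ⟨fun j _ => if j = 0 then 1 else 0, fun _ => const_mem_polyFun _, fun k => ?_⟩
      simp only [ite_smul, one_smul, zero_smul, Finset.sum_ite_eq', Finset.mem_univ, if_true]
      rw [show projPath I (p.sub 0) = projPath I Quiver.Path.nil from rfl, sub_self]
      exact zero_mem _
    | @cons b b' q α ih =>
      obtain ⟨c, hc, hcq⟩ := ih
      have hcons : ∀ i, ∃ c : Fin (l + 1) → (p.Coord → K) → K, (∀ i, c i ∈ polyFun K p.Coord) ∧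
          ∀ k, path I α.toPath • projPath I (p.sub i) - ∑ j, c j k • projPath I (p.sub j) ∈
            psi p k := by
        intro i
        by_cases hb : S i = b
        · subst hb
          simp only [← projPath_cons]
          exact exists_polyFun_cons p i α
        · refine ⟨fun _ _ => 0, fun _ => const_mem_polyFun 0, fun k => ?_⟩
          rw [show path I α.toPath • projPath I (p.sub i) = 0 from
            Subtype.ext (path_mul_path_of_ne I _ _ hb)]
          simp
      choose e he heq using hcons
      refine ⟨fun j k => ∑ i, c i k * e i j k, fun j => sum_mem_polyFun _ fun i _ =>
        mul_mem_polyFun (hc i) (he i j), fun k => ?_⟩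
      have h1 := Submodule.smul_mem (psi p k) (path I α.toPath) (hcq k)
      have h2 : ∑ i, c i k • (path I α.toPath • projPath I (p.sub i) -
          ∑ j, e i j k • projPath I (p.sub j)) ∈ psi p k :=
        Submodule.sum_mem _ fun i _ => Submodule.smul_of_tower_mem _ _ (heq i k)
      have h3 := add_mem h1 h2
      rw [smul_sub, ← projPath_cons, Finset.smul_sum] at h3
      convert h3 using 1
      simp only [smul_sub, Finset.sum_sub_distrib, Finset.smul_sum, Finset.sum_smul, smul_smul]
      rw [Finset.sum_comm]
      simp only [smul_comm (path I α.toPath)]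
      abel
  have hx : ∀ y : QuiverAlgebra I,
      ∃ c : Fin (l + 1) → (p.Coord → K) → K, (∀ i, c i ∈ polyFun K p.Coord) ∧
        ∀ k, y • projPath I Quiver.Path.nil - ∑ i, c i k • projPath I (p.sub i) ∈ psi p k := by
    intro y
    induction y using path_induction with
    | h0 => exact ⟨fun _ _ => 0, fun _ => const_mem_polyFun 0, fun k => by simp⟩
    | hadd x y hx hy =>
      obtain ⟨c, hc, h⟩ := hx
      obtain ⟨c', hc', h'⟩ := hy
      refine ⟨fun i => c i + c' i, fun i => add_mem (hc i) (hc' i), fun k => ?_⟩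
      convert add_mem (h k) (h' k) using 1
      simp only [Pi.add_apply, add_smul, Finset.sum_add_distrib]
      abel
    | hsmul a x hx =>
      obtain ⟨c, hc, h⟩ := hx
      refine ⟨fun i => a • c i, fun i => Subalgebra.smul_mem _ (hc i) a, fun k => ?_⟩
      convert Submodule.smul_of_tower_mem (psi p k) a (h k) using 1
      simp only [Pi.smul_apply, smul_assoc, smul_sub, Finset.smul_sum]
    | @hpath a b q =>
      by_cases ha : S 0 = a
      · subst ha
        rw [show path I q • projPath I Quiver.Path.nil = projPath I q from
          Subtype.ext (path_mul_idem I q)]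
        exact hpath q
      · refine ⟨fun _ _ => 0, fun _ => const_mem_polyFun 0, fun k => ?_⟩
        rw [show path I q • projPath I (Quiver.Path.nil : Quiver.Path (S 0) (S 0)) = 0 from
          Subtype.ext (path_mul_idem_of_ne I q ha)]
        simp
  rw [← smul_projPath_nil x]
  exact hx x

/-- The submodule `ψ_p(k)` is large enough to be a complement, since it spans `Λe` together with the
right subpaths of `p`. -/
theorem psi_eq_of_le {p : PathThrough I S} {k : p.Coord → K} (hle : psi p k ≤ C)
    (h : IsCompl (C.restrictScalars K) (pathSpan p)) : psi p k = C := by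
  refine le_antisymm hle fun x hx => ?_
  obtain ⟨c, -, hc⟩ := exists_polyFun p x
  have hA : ∑ i, c i k • projPath I (p.sub i) ∈ pathSpan p :=
    Submodule.sum_mem _ fun i _ => Submodule.smul_mem _ _ (Submodule.subset_span ⟨i, rfl⟩)
  have hz : ∑ i, c i k • projPath I (p.sub i) = 0 := by
    refine Submodule.disjoint_def.1 h.disjoint _ ?_ hA
    have := sub_mem hx (hle (hc k))
    rwa [sub_sub_cancel] at this
  have := hc k
  rwa [hz, sub_zero] at this

theorem psi_le {hI : PathAlgebra.IsAdmissible I}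
    {L : ℕ → Submodule (QuiverAlgebra I) (proj I (S 0))}
    (hL : IsFlag hI C L) {p : PathThrough I S} {k : p.Coord → K}
    (hd : ∀ d : Detour p, projPath I d.path - d.combination k ∈ C) : psi p k ≤ C := by
  refine Submodule.span_le.2 ?_
  rintro x (⟨d, rfl⟩ | ⟨b, q, hq, rfl⟩)
  · exact hd d
  · by_contra hcon
    exact hq (hL.isRoute q hcon)

theorem isCompl_psi (hI : PathAlgebra.IsAdmissible I) {p : PathThrough I S} {k : p.Coord → K}
    (hk : k ∈ uniserialSet p) : IsCompl ((psi p k).restrictScalars K) (pathSpan p) := by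
  obtain ⟨C, L, hL, hC, hd⟩ := exists_isFlag_of_mem_uniserialSet hI hk
  rw [psi_eq_of_le (psi_le hL hd) hC]
  exact hC

section

variable (hI : PathAlgebra.IsAdmissible I) [FiniteDimensional K (proj I (S 0))]
  {p : PathThrough I S} (h : IsCompl (C.restrictScalars K) (pathSpan p))

include hI h

theorem coeff_eq_zero_of_isCompl {n : ℕ} {c : Fin (l + 1) → K}
    (hc : ∑ i, c i • projPath I (p.sub i) ∈ radFlag C n) (i : Fin (l + 1)) (hi : (i : ℕ) < n) :
    c i = 0 := by
  have hL := isFlag_radFlag hI h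
  refine hL.coeff_eq_zero (projPath_subpath_mem hI hL.zero hL.rad p.1)
    (projPath_subpath_notMem hI hL.rad p.1 ?_) hc i hi
  rw [hL.last]
  exact projPath_sub_notMem_of_isCompl h (Fin.last l)

theorem coeff_eq_zero_of_mem {c : Fin (l + 1) → K} (hc : ∑ i, c i • projPath I (p.sub i) ∈ C) :
    c = 0 := funext fun i => by
  rw [← (isFlag_radFlag hI h).last] at hc
  exact coeff_eq_zero_of_isCompl hI h hc i i.2

theorem linearIndependent_projPath_sub :
    LinearIndependent K fun i => projPath I (p.sub i) := by
  rw [Fintype.linearIndependent_iff]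
  intro c hc i
  have := coeff_eq_zero_of_mem hI h (c := c) (by rw [hc]; exact zero_mem _)
  rw [this, Pi.zero_apply]

theorem finrank_eq_kernelDim : Module.finrank K (C.restrictScalars K) = kernelDim I S := by
  have h1 := Submodule.finrank_add_eq_of_isCompl h
  have h2 : Module.finrank K (pathSpan p) = l + 1 := by
    rw [pathSpan, finrank_span_eq_card (linearIndependent_projPath_sub hI h), Fintype.card_fin]
  rw [kernelDim]
  omega

/-- A detour `α p_m` lies in the layer `m + 1` of the radical filtration of `Λe / C`, and it ends in
the same vertex as `α`; hence modulo `C` it is a combination of those `p_i` with `i ∈ I(α, p_m)`. -/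
theorem exists_combination (d : Detour p) :
    ∃ c : d.Index → K, ∀ k : p.Coord → K, (∀ i, k ⟨d, i⟩ = c i) →
      projPath I d.path - d.combination k ∈ C := by
  classical
  have hL := isFlag_radFlag hI h
  obtain ⟨y, hy, z, hz, hyz⟩ := Submodule.mem_sup.1
    (show projPath I d.path ∈ C.restrictScalars K ⊔ pathSpan p by
      rw [h.sup_eq_top]; trivial)
  obtain ⟨c, rfl⟩ := (Submodule.mem_span_range_iff_exists_fun K).1 hz
  have hC : projPath I d.path - ∑ i, c i • projPath I (p.sub i) ∈ C := by
    rw [← hyz, add_sub_cancel_right]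
    exact hy
  have hm : projPath I d.path ∈ radFlag C (d.m + 1) := by
    rw [Detour.path, projPath_cons]
    refine hL.rad d.m (by omega) _ ?_ _ (projPath_subpath_mem hI hL.zero hL.rad p.1 d.m)
    rw [jacobson_eq_longPaths hI]
    exact path_mem_longPaths (by simp)
  have hlow : ∀ i, ¬ d.m < i → c i = 0 := by
    intro i hi
    refine coeff_eq_zero_of_isCompl hI h (n := d.m + 1) ?_ i ?_
    · have := sub_mem hm (le_radFlag (d.m + 1) hC)
      rwa [sub_sub_cancel] at this
    · rw [not_lt, Fin.le_def] at hi
      omega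
  -- Compare the relation with its multiple by the idempotent at the end of `α`.
  have hvertex : ∀ i, S i ≠ d.tgt → c i = 0 := by
    have h1 := sub_mem (Submodule.smul_mem C (idem I d.tgt) hC) hC
    rw [smul_sub, idem_smul_projPath, sub_sub_sub_cancel_left, Finset.smul_sum,
      ← Finset.sum_sub_distrib] at h1
    have h2 : ∑ i, (if S i = d.tgt then 0 else c i) • projPath I (p.sub i) ∈ C := by
      convert h1 using 1
      refine Finset.sum_congr rfl fun i _ => ?_
      rw [smul_comm]
      by_cases hi : S i = d.tgt
      · rw [if_pos hi, ← hi, idem_smul_projPath, zero_smul, sub_self]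
      · rw [if_neg hi, idem_smul_projPath_of_ne _ hi, smul_zero, sub_zero]
    intro i hi
    have := congrFun (coeff_eq_zero_of_mem hI h h2) i
    simpa [hi] using this
  refine ⟨fun i => c i.1, fun k hk => ?_⟩
  rw [d.combination_eq_sum]
  convert hC using 4 with i
  by_cases hi : d.m < i ∧ S i = d.tgt
  · exact (d.coeff_index ⟨i, hi⟩ k).trans (hk _)
  · rw [Detour.coeff, dif_neg hi]
    by_cases h1 : d.m < i
    · exact (hvertex i fun h2 => hi ⟨h1, h2⟩).symm
    · exact (hlow i h1).symm

theorem exists_psi_eq : ∃ k ∈ uniserialSet p, psi p k = C := by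
  choose c hc using exists_combination hI h
  let k : p.Coord → K := fun x => c x.1 x.2
  have hd : ∀ d : Detour p, projPath I d.path - d.combination k ∈ C := fun d =>
    hc d k fun _ => rfl
  exact ⟨k, mem_uniserialSet_of_isCompl hI h hd, psi_eq_of_le (psi_le (isFlag_radFlag hI h) hd) h⟩

end

theorem psi_injOn (hI : PathAlgebra.IsAdmissible I) [FiniteDimensional K (proj I (S 0))]
    (p : PathThrough I S) : Set.InjOn (psi p) (uniserialSet p) := by
  intro k hk k' _ heq
  ext ⟨d, i⟩
  have h1 : projPath I d.path - d.combination k ∈ psi p k :=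
    Submodule.subset_span (Or.inl ⟨d, rfl⟩)
  have h2 : projPath I d.path - d.combination k' ∈ psi p k := by
    rw [heq]
    exact Submodule.subset_span (Or.inl ⟨d, rfl⟩)
  have h3 := sub_mem h2 h1
  rw [sub_sub_sub_cancel_left, d.combination_eq_sum, d.combination_eq_sum,
    ← Finset.sum_sub_distrib] at h3
  simp only [← sub_smul] at h3
  have h4 := congrFun (coeff_eq_zero_of_mem hI (isCompl_psi hI hk) h3) i.1
  rwa [d.coeff_index, d.coeff_index, Pi.zero_apply, sub_eq_zero] at h4

/-- The set `𝒢-Uni(p)` of the points of `𝒢-Uni(S)` which complement the span of the right subpaths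
of `p`. -/
def cell (p : PathThrough I S) : Set (gUniSet I S) := {C | IsCompl C.1.1 (pathSpan p)}

/-- A point of `𝒢-Uni(S)`, as a `Λ`-submodule of `Λe`. -/
def toSubmodule (C : gUniSet I S) : Submodule (QuiverAlgebra I) (proj I (S 0)) where
  __ := C.1.1
  smul_mem' a _ hx := C.2.1 a _ hx

section cell

variable (hI : PathAlgebra.IsAdmissible I) [FiniteDimensional K (proj I (S 0))]

/-- A basis of `Λe` indexed by the steps of a path through `S` and by the dimension of the points of
`𝒢-Uni(S)`. -/
noncomputable def sumBasis (p : PathThrough I S) :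
    Module.Basis (Fin (l + 1) ⊕ Fin (kernelDim I S)) K (proj I (S 0)) :=
  (Module.finBasisOfFinrankEq K (proj I (S 0)) (n := l + 1 + kernelDim I S) (by
    have := le_finrank_proj hI p
    rw [kernelDim]
    omega)).reindex finSumFinEquiv.symm

include hI in
/-- The cell of `p` is the set on which the Plücker coordinate given by the right subpaths of `p`
does not vanish. -/
theorem isOpen_cell (p : PathThrough I S) : (gUni I S).top.IsOpen (cell p) := by
  classical
  let ω := Gr.detForm (sumBasis hI p) fun i => projPath I (p.sub i)
  refine ⟨_, Gr.isOpen_basic (MvPolynomial.isHomogeneous_X K ω), ?_⟩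
  ext C
  have hX : ∀ v, Gr.pluckerEval v (MvPolynomial.X ω) = ω v := fun v => by simp [Gr.pluckerEval]
  constructor
  · rintro ⟨v, hv, hne⟩
    rw [hX] at hne
    exact (hv.isCompl_iff _ _).2 hne
  · intro hC
    obtain ⟨v, hv⟩ := Gr.exists_isFrame C.1
    refine ⟨v, hv, ?_⟩
    rw [hX]
    exact (hv.isCompl_iff _ _).1 hC

/-- The map `ψ_p` from `V_p` to the cell of `p`. -/
noncomputable def psiCell (p : PathThrough I S) (k : uniserialSet p) : cell p :=
  ⟨⟨⟨(psi p k.1).restrictScalars K, finrank_eq_kernelDim hI (isCompl_psi hI k.2)⟩,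
    fun a _ hx => Submodule.smul_mem (psi p k.1) a hx, p, isCompl_psi hI k.2⟩,
    isCompl_psi hI k.2⟩

theorem psiCell_bijective (p : PathThrough I S) : Function.Bijective (psiCell hI p) := by
  constructor
  · intro k k' h
    refine Subtype.ext (psi_injOn hI p k.2 k'.2 ?_)
    exact Submodule.restrictScalars_injective K _ _
      (congrArg (fun C : cell p => C.1.1.1) h)
  · intro C
    obtain ⟨k, hk, hkC⟩ := exists_psi_eq hI (C := toSubmodule C.1) (p := p) C.2
    refine ⟨⟨k, hk⟩, Subtype.ext (Subtype.ext (Subtype.ext ?_))⟩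
    change (psi p k).restrictScalars K = _
    rw [hkC]
    rfl

/-- The bases of `ψ_p(k)` obtained by reducing the members of a fixed basis modulo `ψ_p(k)` depend
polynomially on `k`. -/
theorem isMor_psiCell (p : PathThrough I S) :
    IsMor (uniserialVariety p) ((gUni I S).induce (cell p)) (psiCell hI p) := by
  have hA := Gr.restricts_grassmannian (K := K) (W := proj I (S 0)) (m := kernelDim I S)
  have hV := (restricts_affineSpace (K := K) (κ := p.Coord)).isSheaf_induce (uniserialSet p)
  refine isMor_of_val hV (isMor_of_val hV ?_)
  rcases isEmpty_or_nonempty (uniserialSet p) with hE | ⟨⟨k₀⟩⟩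
  · exact isMor_grassmannian (v := fun _ _ => 0) _ (fun y => (hE.false y).elim)
      fun ω => const_mem_polyFun (ω fun _ => 0)
  · obtain ⟨w, hw⟩ := Gr.exists_isFrame (psiCell hI p k₀).1.1
    choose c hc hcw using fun j => exists_polyFun p (w j)
    refine isMor_grassmannian
      (v := fun k j => w j - ∑ i, c j i k • projPath I (p.sub i)) _ (fun k => ?_) ?_
    · have hmem : ∀ j, w j - ∑ i, c j i k.1 • projPath I (p.sub i) ∈
          (psi p k.1).restrictScalars K := fun j => hcw j k
      have hind : LinearIndependent K fun j =>
          w j - ∑ i, c j i k.1 • projPath I (p.sub i) := by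
        rw [Fintype.linearIndependent_iff]
        intro a ha
        refine Fintype.linearIndependent_iff.1 hw.1 a ?_
        have h1 : ∑ j, a j • w j ∈ pathSpan p := by
          simp only [smul_sub, Finset.sum_sub_distrib, sub_eq_zero] at ha
          rw [ha]
          exact Submodule.sum_mem _ fun j _ => Submodule.smul_mem _ _ (Submodule.sum_mem _
            fun i _ => Submodule.smul_mem _ _ (Submodule.subset_span ⟨i, rfl⟩))
        have h2 : ∑ j, a j • w j ∈ (psiCell hI p k₀).1.1.1 := by
          rw [← hw.2]
          exact Submodule.sum_mem _ fun j _ => Submodule.smul_mem _ _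
            (Submodule.subset_span ⟨j, rfl⟩)
        exact Submodule.disjoint_def.1 (psiCell hI p k₀).2.disjoint _ h2 h1
      refine ⟨hind, Submodule.eq_of_le_of_finrank_le ?_ ?_⟩
      · rw [Submodule.span_le]
        rintro _ ⟨j, rfl⟩
        exact hmem j
      · rw [finrank_span_eq_card hind, Fintype.card_fin]
        exact (psiCell hI p k).1.1.2.le
    · refine alternatingMap_mem_polyFun (Module.finBasis K (proj I (S 0))) fun j i => ?_
      simp only [map_sub, map_sum, map_smul, Finsupp.sub_apply, Finsupp.coe_finsetSum,
        Finset.sum_apply, Finsupp.smul_apply, smul_eq_mul]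
      exact sub_mem (const_mem_polyFun _) (sum_mem_polyFun _ fun i' _ =>
        mul_mem_polyFun (hc j i') (const_mem_polyFun _))

/-- The isomorphism `ψ_p` between `V_p` and the cell of `p`. Its inverse is a morphism since, by
Cramer's rule, the coefficients of the detours modulo `C` are quotients of Plücker coordinates of
`C`, with a denominator which does not vanish on the cell. -/
noncomputable def psiIso (p : PathThrough I S) :
    (uniserialVariety p).Iso ((gUni I S).induce (cell p)) :=
  Iso.ofMor (Equiv.ofBijective _ (psiCell_bijective hI p)) (isMor_psiCell hI p) <| by
    classical
    have hX := (restricts_induce (Gr.grassmannian K (proj I (S 0)) (kernelDim I S))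
      (gUniSet I S)).isSheaf_induce (cell p)
    refine isMor_of_val hX ?_
    refine isMor_affineSpace hX ((isMor_val _ (gUniSet I S)).comp (isMor_val _ (cell p)))
      (Gr.detForm (sumBasis hI p) fun i => projPath I (p.sub i))
      (fun x => Gr.detForm (sumBasis hI p)
        (Function.update (fun i => projPath I (p.sub i)) x.2.1 (projPath I x.1.path)))
      (fun C v hv => (hv.isCompl_iff _ _).1 C.2) fun C v hv => ?_
    obtain ⟨k, rfl⟩ := (psiCell_bijective hI p).2 C
    rintro ⟨d, i⟩
    rw [show (Equiv.ofBijective _ (psiCell_bijective hI p)).symm (psiCell hI p k) = k from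
      Equiv.ofBijective_symm_apply_apply _ _ _]
    have h : projPath I d.path - ∑ i, d.coeff i k.1 • projPath I (p.sub i) ∈ psi p k.1 := by
      rw [← d.combination_eq_sum]
      exact Submodule.subset_span (Or.inl ⟨d, rfl⟩)
    rw [hv.detForm_update (sumBasis hI p) _ h i.1, d.coeff_index]

end cell

end Psi

end QuiverAlgebra

/-! ### Birational equivalence from overlapping charts -/

namespace SpaceWithFunctions

section Overlap

variable {K X Y X' Y' : Type*} {A : SpaceWithFunctions K X} {B : SpaceWithFunctions K Y}
  {A' : SpaceWithFunctions K X'} {B' : SpaceWithFunctions K Y'}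
  {O : Set Y} {O' : Set Y'} (e : A.Iso (B.induce O)) (e' : A'.Iso (B'.induce O'))
  (φ : Y → Y') (φ' : Y' → Y) (D : Set X) (D' : Set X')

/-- The part of `D` on which the chart `e`, followed by `φ`, takes values in the domain of the chart
`e'`. -/
def overlap : Set D := {x | φ (e.toEquiv x.1).1 ∈ O'}

variable {φ φ' D D'} {Z : Set Y} {Z' : Set Y'}

/-- The transition map between two charts. -/
def transition (hφ' : ∀ y, φ' (φ y) = y) (hφZ : ∀ y ∈ Z, φ y ∈ Z')
    (hD : ∀ x, x ∈ D ↔ (e.toEquiv x).1 ∈ Z) (hD' : ∀ x, x ∈ D' ↔ (e'.toEquiv x).1 ∈ Z')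
    (x : overlap (O' := O') e φ D) : overlap (O' := O) e' φ' D' :=
  ⟨⟨e'.toEquiv.symm ⟨φ (e.toEquiv x.1.1).1, x.2⟩, by
    rw [hD', Equiv.apply_symm_apply]
    exact hφZ _ ((hD _).1 x.1.2)⟩, by
    change φ' (e'.toEquiv (e'.toEquiv.symm _)).1 ∈ O
    rw [Equiv.apply_symm_apply, hφ']
    exact (e.toEquiv x.1.1).2⟩

variable (hφ' : ∀ y, φ' (φ y) = y) (hφ : ∀ y, φ (φ' y) = y) (hφZ : ∀ y ∈ Z, φ y ∈ Z')
  (hφZ' : ∀ y ∈ Z', φ' y ∈ Z) (hD : ∀ x, x ∈ D ↔ (e.toEquiv x).1 ∈ Z)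
  (hD' : ∀ x, x ∈ D' ↔ (e'.toEquiv x).1 ∈ Z')

theorem transition_transition (x : overlap (O' := O') e φ D) :
    transition e' e hφ hφZ' hD' hD (transition e e' hφ' hφZ hD hD' x) = x := by
  refine Subtype.ext (Subtype.ext ?_)
  change e.toEquiv.symm ⟨φ' (e'.toEquiv (e'.toEquiv.symm _)).1, _⟩ = _
  rw [Equiv.symm_apply_eq]
  refine Subtype.ext ?_
  change φ' (e'.toEquiv (e'.toEquiv.symm _)).1 = _
  rw [Equiv.apply_symm_apply, hφ']

theorem isMor_transition (h : IsMor B B' φ) :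
    IsMor ((A.induce D).induce (overlap (O' := O') e φ D))
      ((A'.induce D').induce (overlap (O' := O) e' φ' D')) (transition e e' hφ' hφZ hD hD') := by
  have hs := (restricts_induce A D).isSheaf_induce (overlap (O' := O') e φ D)
  refine isMor_of_val hs (isMor_of_val hs ?_)
  refine e'.isMor_symm.comp (h := fun x : overlap (O' := O') e φ D =>
    (⟨φ (e.toEquiv x.1.1).1, x.2⟩ : O')) (isMor_of_val hs ?_)
  exact h.comp ((isMor_val B O).comp (e.isMor.comp ((isMor_val A D).comp (isMor_val _ _))))

end Overlap

section Topology

variable {K X Y X' Y' : Type*} {A : SpaceWithFunctions K X} {B : SpaceWithFunctions K Y}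
  {A' : SpaceWithFunctions K X'} {B' : SpaceWithFunctions K Y'} {O : Set Y} {O' : Set Y'}

open Topology

theorem Iso.isOpenEmbedding (e : A.Iso (B.induce O)) (hO : B.top.IsOpen O) :
    @IsOpenEmbedding X Y A.top B.top fun x => (e.toEquiv x).1 := by
  let := A.top
  let := B.top
  let h : X ≃ₜ O := e.toEquiv.toHomeomorph fun s => (e.isOpen_iff s).symm
  exact (IsOpen.isOpenEmbedding_subtypeVal hO).comp h.isOpenEmbedding

theorem Iso.image_mem_components (e : A.Iso B) {Z : Set X} (hZ : Z ∈ A.components) :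
    e.toEquiv '' Z ∈ B.components := by
  let := A.top
  let := B.top
  let h : X ≃ₜ Y := e.toEquiv.toHomeomorph fun s => (e.isOpen_iff s).symm
  have h1 := h.isOpenEmbedding.closure_image_mem_irreducibleComponents hZ
  rw [(h.isClosedMap _ (isClosed_of_mem_irreducibleComponents Z hZ)).closure_eq] at h1
  exact h1

/-- Closed subvarieties of two charts which have the same closure `Z` are birationally equivalent:
their overlap is open in both, and not empty since `Z` is irreducible. -/
theorem birational_of_charts (e : A.Iso (B.induce O)) (hO : B.top.IsOpen O)
    (e' : A'.Iso (B'.induce O')) (hO' : B'.top.IsOpen O') (φ : B.Iso B') {Z : Set Y}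
    (hZ : Z ∈ B.components) {D : Set X} {D' : Set X'} (hne : D.Nonempty) (hne' : D'.Nonempty)
    (hD : ∀ x, x ∈ D ↔ (e.toEquiv x).1 ∈ Z)
    (hD' : ∀ x, x ∈ D' ↔ (e'.toEquiv x).1 ∈ φ.toEquiv '' Z) :
    (A.induce D).Birational (A'.induce D') := by
  have hφ' : ∀ y, φ.toEquiv.symm (φ.toEquiv y) = y := φ.toEquiv.symm_apply_apply
  have hφ : ∀ y, φ.toEquiv (φ.toEquiv.symm y) = y := φ.toEquiv.apply_symm_apply
  have hφZ : ∀ y ∈ Z, φ.toEquiv y ∈ φ.toEquiv '' Z := fun y hy => ⟨y, hy, rfl⟩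
  have hφZ' : ∀ y ∈ φ.toEquiv '' Z, φ.toEquiv.symm y ∈ Z := by
    rintro _ ⟨y, hy, rfl⟩
    rwa [hφ']
  let t := transition e e' hφ' hφZ hD hD'
  let t' := transition e' e hφ hφZ' hD' hD
  have hU : (overlap (O' := O') e φ.toEquiv D).Nonempty := by
    obtain ⟨x, hx⟩ := hne
    obtain ⟨x', hx'⟩ := hne'
    obtain ⟨z, hz, hzx'⟩ := (hD' x').1 hx'
    obtain ⟨y, hyZ, hyO, hyO'⟩ := hZ.1.2 O (φ.toEquiv ⁻¹' O') hO (φ.isMor.isOpen_preimage _ hO')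
      ⟨_, (hD x).1 hx, (e.toEquiv x).2⟩ ⟨z, hz, by
        rw [Set.mem_preimage, hzx']
        exact (e'.toEquiv x').2⟩
    have hy : (e.toEquiv (e.toEquiv.symm ⟨y, hyO⟩)).1 = y := by rw [Equiv.apply_symm_apply]
    refine ⟨⟨e.toEquiv.symm ⟨y, hyO⟩, (hD _).2 (by rwa [hy])⟩, ?_⟩
    change φ.toEquiv (e.toEquiv (e.toEquiv.symm ⟨y, hyO⟩)).1 ∈ O'
    rwa [hy]
  refine ⟨overlap (O' := O') e φ.toEquiv D, overlap (O' := O) e' φ.toEquiv.symm D',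
    ?_, hU, ?_, ?_, ⟨Iso.ofMor ⟨t, t', ?_, ?_⟩ ?_ ?_⟩⟩
  · exact (φ.isMor.comp ((isMor_val B O).comp (e.isMor.comp (isMor_val A D)))).isOpen_preimage _ hO'
  · exact (φ.isMor_symm.comp
      ((isMor_val B' O').comp (e'.isMor.comp (isMor_val A' D')))).isOpen_preimage _ hO
  · obtain ⟨x, hx⟩ := hU
    exact ⟨_, (t ⟨x, hx⟩).2⟩
  · exact transition_transition e e' hφ' hφ hφZ hφZ' hD hD'
  · exact transition_transition e' e hφ hφ' hφZ' hφZ hD' hD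
  · exact isMor_transition e e' hφ' hφZ hD hD' φ.isMor
  · exact isMor_transition e' e hφ hφZ' hD' hD φ.isMor_symm

end Topology

end SpaceWithFunctions

/-! ### The patches -/

namespace QuiverAlgebra

section Patches

universe u v w

open SpaceWithFunctions

variable {K : Type u} [Field K] {V : Type v} [Fintype V] [Quiver.{w} V]
variable {I : Ideal (PathAlgebra K V)} [I.IsTwoSided] {l : ℕ} {S : Fin (l + 1) → V}
variable (hI : PathAlgebra.IsAdmissible I) [FiniteDimensional K (proj I (S 0))]

include hI

theorem patchClosure_eq (p : PathThrough I S) (D : Set (uniserialSet p)) :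
    patchClosure p D = (gUni I S).cl ((fun k => ((psiIso hI p).toEquiv k).1) '' D) := by
  refine congrArg (gUni I S).cl ?_
  ext C
  refine exists_congr fun k => and_congr_right fun _ => ⟨fun h => ?_, ?_⟩
  · exact Subtype.ext (Subtype.ext h.symm)
  · rintro rfl
    rfl

theorem patchClosure_mem_components {p : PathThrough I S} {D : Set (uniserialSet p)}
    (hD : D ∈ (uniserialVariety p).components) : patchClosure p D ∈ (gUni I S).components := by
  let := (uniserialVariety p).top
  let := (gUni I S).top
  rw [patchClosure_eq hI]
  have hj := (psiIso hI p).isOpenEmbedding (isOpen_cell hI p)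
  exact hj.closure_image_mem_irreducibleComponents hD

/-- A component of `V_p` is the preimage of its patch. -/
theorem mem_iff_mem_patchClosure {p : PathThrough I S} {D : Set (uniserialSet p)}
    (hD : D ∈ (uniserialVariety p).components) (k : uniserialSet p) :
    k ∈ D ↔ ((psiIso hI p).toEquiv k).1 ∈ patchClosure p D := by
  let := (uniserialVariety p).top
  let := (gUni I S).top
  have h := ((psiIso hI p).isOpenEmbedding (isOpen_cell hI p)).preimage_closure_image
    (isClosed_of_mem_irreducibleComponents D hD)
  rw [patchClosure_eq hI]
  exact (Set.ext_iff.1 h k).symm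

theorem patchClosure_injOn (p : PathThrough I S) :
    Set.InjOn (patchClosure p) (uniserialVariety p).components := by
  intro D hD D' hD' h
  ext k
  rw [mem_iff_mem_patchClosure hI hD, mem_iff_mem_patchClosure hI hD', h]

/-- The patches are precisely the irreducible components of `𝒢-Uni(S)`. -/
theorem patchComponents_eq : PatchComponents I S = (gUni I S).components := by
  ext Z
  constructor
  · rintro ⟨p, D, hD, rfl⟩
    exact patchClosure_mem_components hI hD
  · intro hZ
    obtain ⟨C, hC⟩ := hZ.1.1
    obtain ⟨p, hp⟩ := C.2.2
    let := (uniserialVariety p).top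
    let := (gUni I S).top
    have hj := (psiIso hI p).isOpenEmbedding (isOpen_cell hI p)
    have hne : ((fun k => ((psiIso hI p).toEquiv k).1) ⁻¹' Z).Nonempty := by
      refine ⟨(psiIso hI p).toEquiv.symm ⟨C, hp⟩, ?_⟩
      rw [Set.mem_preimage, Equiv.apply_symm_apply]
      exact hC
    refine ⟨p, _, hj.preimage_mem_irreducibleComponents hZ hne, ?_⟩
    rw [patchClosure_eq hI]
    exact (hj.closure_image_preimage hZ.1 (isClosed_of_mem_irreducibleComponents Z hZ) hne).symm

end Patches

end QuiverAlgebra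

/-! ### Transport along an isomorphism of algebras -/

namespace QuiverAlgebra

section Transport

open SpaceWithFunctions

variable {K : Type*} [Field K] {V : Type*} [Fintype V] [Quiver V]
variable {I : Ideal (PathAlgebra K V)} [I.IsTwoSided]
variable {V' : Type*} [Fintype V'] [Quiver V']
variable {I' : Ideal (PathAlgebra K V')} [I'.IsTwoSided]
variable {l : ℕ} {S : Fin (l + 1) → V} {S' : Fin (l + 1) → V'}
variable (f : QuiverAlgebra I ≃ₐ[K] QuiverAlgebra I')
  (T : proj I (S 0) ≃ₗ[K] proj I' (S' 0)) (hT : ∀ a x, T (a • x) = f a • T x)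

/-- The image of a submodule under an `f`-semilinear isomorphism. -/
noncomputable def mapSubmodule (N : Submodule (QuiverAlgebra I) (proj I (S 0))) :
    Submodule (QuiverAlgebra I') (proj I' (S' 0)) where
  __ := (N.restrictScalars K).map (T : proj I (S 0) →ₗ[K] proj I' (S' 0))
  smul_mem' := by
    rintro a _ ⟨x, hx, rfl⟩
    refine ⟨f.symm a • x, N.smul_mem _ hx, ?_⟩
    change T (f.symm a • x) = _
    rw [hT, AlgEquiv.apply_symm_apply]
    rfl

theorem apply_mem_mapSubmodule {N : Submodule (QuiverAlgebra I) (proj I (S 0))}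
    {x : proj I (S 0)} : T x ∈ mapSubmodule f T hT N ↔ x ∈ N := by
  constructor
  · rintro ⟨y, hy, hyx⟩
    rwa [← T.injective hyx]
  · exact fun hx => ⟨x, hx, rfl⟩

variable {hI : PathAlgebra.IsAdmissible I} {hI' : PathAlgebra.IsAdmissible I'}
  (hχ : ∀ i y, vertexChar hI' (S' i) (f y) = vertexChar hI (S i) y)

include hχ

theorem IsFlag.map {C : Submodule (QuiverAlgebra I) (proj I (S 0))}
    {L : ℕ → Submodule (QuiverAlgebra I) (proj I (S 0))} (h : IsFlag hI C L) :
    IsFlag hI' (mapSubmodule f T hT C) fun i => mapSubmodule f T hT (L i) where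
  zero := by
    rw [eq_top_iff]
    rintro x -
    obtain ⟨x, rfl⟩ := T.surjective x
    rw [apply_mem_mapSubmodule, h.zero]
    trivial
  last := congrArg _ h.last
  anti i j hij x := by
    obtain ⟨x, rfl⟩ := T.surjective x
    rw [apply_mem_mapSubmodule, apply_mem_mapSubmodule]
    exact fun hx => h.anti hij hx
  char i a x hx := by
    obtain ⟨x, rfl⟩ := T.surjective x
    obtain ⟨a, rfl⟩ := f.surjective a
    rw [apply_mem_mapSubmodule] at hx
    rw [hχ, ← hT, ← map_smul, ← map_sub, apply_mem_mapSubmodule]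
    exact h.char i a x hx
  line i x y hx hx' hy := by
    obtain ⟨x, rfl⟩ := T.surjective x
    obtain ⟨y, rfl⟩ := T.surjective y
    rw [apply_mem_mapSubmodule] at hx hx' hy
    obtain ⟨c, hc⟩ := h.line i x y hx hx' hy
    refine ⟨c, ?_⟩
    rwa [← map_smul, ← map_sub, apply_mem_mapSubmodule]

/-- Complementing the span of the right subpaths of some path through `S` is a property which only
depends on the module structure, since it can be expressed by means of flags. -/
theorem exists_isCompl_mapSubmodule [FiniteDimensional K (proj I (S 0))]
    {C : Submodule (QuiverAlgebra I) (proj I (S 0))} {p : PathThrough I S}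
    (h : IsCompl (C.restrictScalars K) (pathSpan p)) :
    ∃ p' : PathThrough I' S',
      IsCompl ((mapSubmodule f T hT C).restrictScalars K) (pathSpan p') := by
  have hL := isFlag_radFlag hI h
  have hp := projPath_subpath_mem hI hL.zero hL.rad p.1
  have hp' := projPath_subpath_notMem hI hL.rad p.1 (by
    rw [hL.last]
    exact projPath_sub_notMem_of_isCompl h (Fin.last l))
  refine (hL.map f T hT hχ).exists_pathThrough (fun htop => ?_) fun i hi => ?_
  · have : T (projPath I (subpath p.1 0)) ∈ mapSubmodule f T hT (radFlag C 1) := by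
      rw [htop]
      trivial
    rw [apply_mem_mapSubmodule] at this
    exact hp' 0 this
  · have hα : path I (p.1 ⟨i, hi⟩).toPath ∈ Ring.jacobson (QuiverAlgebra I) := by
      rw [jacobson_eq_longPaths hI]
      exact path_mem_longPaths (by simp)
    refine ⟨f (path I (p.1 ⟨i, hi⟩).toPath), (apply_mem_jacobson f).2 hα,
      T (projPath I (subpath p.1 (⟨i, hi⟩ : Fin l).castSucc)), ?_, ?_⟩
    · rw [apply_mem_mapSubmodule]
      exact hp (⟨i, hi⟩ : Fin l).castSucc
    · rw [← hT, apply_mem_mapSubmodule, ← projPath_subpath_succ]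
      exact hp' (⟨i, hi⟩ : Fin l).succ

include hT in
theorem map_mem_gUniSet [FiniteDimensional K (proj I (S 0))]
    (hm : kernelDim I S = kernelDim I' S') (C : gUniSet I S) : Gr.map T hm C.1 ∈ gUniSet I' S' := by
  obtain ⟨p, hp⟩ := C.2.2
  refine ⟨fun a x hx => (mapSubmodule f T hT (toSubmodule C)).smul_mem a hx, ?_⟩
  exact exists_isCompl_mapSubmodule f T hT hχ (C := toSubmodule C) (p := p) hp

/-- The isomorphism between the varieties of uniserial modules induced by a semilinear isomorphism
of projective modules. -/
noncomputable def gUniIso [FiniteDimensional K (proj I (S 0))]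
    [FiniteDimensional K (proj I' (S' 0))] (hm : kernelDim I S = kernelDim I' S') :
    (gUni I S).Iso (gUni I' S') :=
  have hT' : ∀ a x, T.symm (a • x) = f.symm a • T.symm x := fun a x => by
    rw [LinearEquiv.symm_apply_eq, hT, AlgEquiv.apply_symm_apply, LinearEquiv.apply_symm_apply]
  have hχ' : ∀ i y, vertexChar hI (S i) (f.symm y) = vertexChar hI' (S' i) y := fun i y => by
    rw [← hχ, AlgEquiv.apply_symm_apply]
  Iso.ofMor
    { toFun := fun C => ⟨Gr.map T hm C.1, map_mem_gUniSet f T hT hχ hm C⟩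
      invFun := fun C => ⟨Gr.map T.symm hm.symm C.1,
        map_mem_gUniSet f.symm T.symm hT' hχ' hm.symm C⟩
      left_inv := fun C => Subtype.ext (Subtype.ext (by
        change (C.1.1.map _).map _ = _
        rw [← Submodule.map_comp]
        simp))
      right_inv := fun C => Subtype.ext (Subtype.ext (by
        change (C.1.1.map _).map _ = _
        rw [← Submodule.map_comp]
        simp)) }
    (isMor_of_val (Gr.restricts_grassmannian.isSheaf_induce _)
      ((Gr.isMor_map T hm).comp (isMor_val _ _)))
    (isMor_of_val (Gr.restricts_grassmannian.isSheaf_induce _)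
      ((Gr.isMor_map T.symm hm.symm).comp (isMor_val _ _)))

end Transport

end QuiverAlgebra

/-! ### Isomorphic algebras have isomorphic varieties of uniserial modules -/

open QuiverAlgebra in
theorem corollaryC {K : Type*} [Field K] [IsAlgClosed K]
    {V : Type*} [Fintype V] [Quiver V] [∀ a b : V, Finite (a ⟶ b)]
    {V' : Type*} [Fintype V'] [Quiver V'] [∀ a b : V', Finite (a ⟶ b)]
    (I : Ideal (PathAlgebra K V)) [I.IsTwoSided] (hI : PathAlgebra.IsAdmissible I)
    (I' : Ideal (PathAlgebra K V')) [I'.IsTwoSided] (hI' : PathAlgebra.IsAdmissible I')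
    (f : QuiverAlgebra I ≃ₐ[K] QuiverAlgebra I')
    {l : ℕ} (S : Fin (l + 1) → V) (S' : Fin (l + 1) → V')
    (hS : ∀ i, ∃ g : Simple I (S i) ≃+ Simple I' (S' i), ∀ a x, g (a • x) = f a • g x) :
    ∃ (T : proj I (S 0) ≃+ proj I' (S' 0)) (φ : (gUni I S).Iso (gUni I' S')),
      (∀ a x, T (a • x) = f a • T x) ∧
      (∀ C : gUniSet I S, ((φ.toEquiv C).1.1 : Set (proj I' (S' 0))) = T '' C.1.1) ∧
      (∀ p : PathThrough I S, Set.InjOn (patchClosure p) (uniserialVariety p).components) ∧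
      (∀ p' : PathThrough I' S', Set.InjOn (patchClosure p') (uniserialVariety p').components) ∧
      ∃ σ : PatchComponents I S ≃ PatchComponents I' S',
        (∀ Z, (σ Z : Set (gUniSet I' S')) = φ.toEquiv '' Z.1) ∧
        ∀ (Z : PatchComponents I S),
          ∀ p : PathThrough I S, ∀ D ∈ (uniserialVariety p).components,
          ∀ p' : PathThrough I' S', ∀ D' ∈ (uniserialVariety p').components,
            Z.1 = patchClosure p D → (σ Z).1 = patchClosure p' D' →
              ((uniserialVariety p).induce D).Birational ((uniserialVariety p').induce D') := by
  have hfin := finiteDimensional_proj hI (S 0)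
  have hfin' := finiteDimensional_proj hI' (S' 0)
  have hχ : ∀ i y, vertexChar hI' (S' i) (f y) = vertexChar hI (S i) y := fun i y => by
    obtain ⟨g, hg⟩ := hS i
    exact vertexChar_apply_of_simple hI hI' f g hg y
  let T : proj I (S 0) ≃ₗ[K] proj I' (S' 0) :=
    LinearEquiv.ofBijective (projMap f (S 0) (S' 0)) (projMap_bijective hI hI' f (hχ 0))
  have hT : ∀ a x, T (a • x) = f a • T x := projMap_smul f (S 0) (S' 0)
  have hm : kernelDim I S = kernelDim I' S' := by rw [kernelDim, kernelDim, T.finrank_eq]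
  let φ := gUniIso f T hT hχ hm
  have hinv : ∀ Z ∈ (gUni I' S').components, φ.toEquiv.symm '' Z ∈ (gUni I S).components :=
    fun Z hZ => (SpaceWithFunctions.Iso.ofMor φ.toEquiv.symm φ.isMor_symm
      φ.isMor).image_mem_components hZ
  refine ⟨T.toAddEquiv, φ, hT, fun C => rfl, patchClosure_injOn hI, patchClosure_injOn hI',
    ⟨fun Z => ⟨φ.toEquiv '' Z.1, ?_⟩, fun Z => ⟨φ.toEquiv.symm '' Z.1, ?_⟩, fun Z => ?_,
      fun Z => ?_⟩, fun Z => rfl, fun Z p D hD p' D' hD' hZ hZ' => ?_⟩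
  · rw [patchComponents_eq hI']
    exact φ.image_mem_components (by rw [← patchComponents_eq hI]; exact Z.2)
  · rw [patchComponents_eq hI]
    exact hinv _ (by rw [← patchComponents_eq hI']; exact Z.2)
  · exact Subtype.ext (φ.toEquiv.symm_image_image Z.1)
  · exact Subtype.ext (φ.toEquiv.image_symm_image Z.1)
  · refine SpaceWithFunctions.birational_of_charts (psiIso hI p) (isOpen_cell hI p)
      (psiIso hI' p') (isOpen_cell hI' p') φ (Z := Z.1) ?_ hD.1.1 hD'.1.1 (fun k => ?_) fun k => ?_
    · rw [← patchComponents_eq hI]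
      exact Z.2
    · rw [hZ]
      exact mem_iff_mem_patchClosure hI hD k
    · have hZ'' : φ.toEquiv '' Z.1 = patchClosure p' D' := hZ'
      rw [hZ'']
      exact mem_iff_mem_patchClosure hI' hD' k
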